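/- **Model.** Consider $k\ge 2$ pairwise-connected quantum processors implementing an $n$-qubit unitary $U$. The $n$ data qubits are distributed by a map $\pi:[n]\to[k]$, and each processor holds in addition $m\ge 0$ ancilla qubits. A distributed circuit is a finite sequence of gates, each of which is either an arbitrary unitary on the qubits of a single processor (a local gate) or an arbitrary two-qubit gate on two qubits that reside on different processors (a nonlocal gate). The circuit $T$ implements $U$ exactly if $T(|\psi\rangle\otimes|0\cdots0\rangle)=(U|\psi\rangle)\otimes|0\cdots0\rangle$ for every $n$-qubit state $|\psi\rangle$, where $|0\cdots0\rangle$ is the state of all $km$ ancillas. For a real $b\ge 1$, call $\pi$ balanced (with slack $b$) if $\bigl||\pi^{-1}(\ell)|-n/k\bigr|<b$ for all $\ell\in[k]$, i.e. every processor holds $n/k+O(1)$ data qubits. The $k$-party communication complexity $\mathcal{C}_m^{(k)}(U)$ is the minimum number of nonlocal gates in a circuit that implements $U$ exactly, over all balanced $\pi$ and all such circuits. **Theorem.** Fix the slack $b\ge 1$. There are constants $C,c>0$ and $n_0\in\mathbb{N}$, depending only on $b$ (in particular not on $n,k,m,U$), such that: (i) for all integers $n,m\ge 0$, $k\ge 2$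 and every $n$-qubit unitary $U$, $$\mathcal{C}_m^{(k)}(U)\le C\cdot\max\{4^{(1-1/k)n-m},\,n\};$$ (ii) for all integers $n\ge n_0$, $m\ge 0$, $k\ge 2$ there exists an $n$-qubit unitary $U$ with $$\mathcal{C}_m^{(k)}(U)\ge c\cdot\max\{4^{(1-1/k)n-m},\,n\}.$$ -/

import Mathlib

namespace DistQC

/-- The unitaries on the qubits labelled by `Q`: unitary matrices whose rows and columns are indexed
by the computational basis `Q → Bool`.  An `n`-qubit unitary is an element of
`QubitUnitary (Fin n)`. -/
abbrev QubitUnitary (Q : Type) [Fintype Q] [DecidableEq Q] : Type :=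
  Matrix.unitaryGroup (Q → Bool) ℂ

/-- The operator `V ⊗ I` on all qubits of `Q`, where `V` acts on the qubits in `S` and the identity
acts on the other qubits. -/
def onQubits {Q : Type} [Fintype Q] [DecidableEq Q] (S : Finset Q)
    (V : Matrix (S → Bool) (S → Bool) ℂ) : Matrix (Q → Bool) (Q → Bool) ℂ :=
  Matrix.of fun x y =>
    if ∀ q, q ∉ S → x q = y q then V (fun q => x q) (fun q => y q) else 0

/-- The qubits of a system of `k` processors: `n` data (input) qubits and, for each processor `i`,
the `m` ancilla qubits `(i, 0), …, (i, m - 1)`. -/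
abbrev Qubit (n k m : ℕ) : Type := Fin n ⊕ (Fin k × Fin m)

/-- The processor that holds a given qubit, when the data qubits are distributed by `π`. -/
def proc {n k m : ℕ} (π : Fin n → Fin k) : Qubit n k m → Fin k :=
  Sum.elim π Prod.fst

/-- The qubits (data and ancillas) held by processor `i`. -/
def qubitsOf {n k : ℕ} (m : ℕ) (π : Fin n → Fin k) (i : Fin k) : Finset (Qubit n k m) :=
  Finset.univ.filter fun q => proc π q = i

/-- The gates of a distributed circuit over the processor topology `G`: an arbitrary unitary on the
qubits of one processor, or an arbitrary two-qubit gate on two qubits that reside on two different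
processors adjacent in `G`. -/
inductive Gate {n k : ℕ} (m : ℕ) (G : SimpleGraph (Fin k)) (π : Fin n → Fin k) : Type
  | loc (i : Fin k) (V : QubitUnitary (qubitsOf m π i)) : Gate m G π
  | nonloc (p q : Qubit n k m) (h : G.Adj (proc π p) (proc π q))
      (V : QubitUnitary ({p, q} : Finset (Qubit n k m))) : Gate m G π

namespace Gate

variable {n k m : ℕ} {G : SimpleGraph (Fin k)} {π : Fin n → Fin k}

/-- The operator of a gate on the whole system. -/
def toMatrix : Gate m G π → Matrix (Qubit n k m → Bool) (Qubit n k m → Bool) ℂ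
  | loc i V => onQubits (qubitsOf m π i) V.1
  | nonloc p q _ V => onQubits {p, q} V.1

/-- The communication cost of a gate: `1` for a nonlocal two-qubit gate and `0` for local gates. -/
def cost : Gate m G π → ℕ
  | loc _ _ => 0
  | nonloc _ _ _ _ => 1

end Gate

/-- A distributed quantum circuit: a finite sequence of gates, the head being applied first. -/
abbrev Circuit {n k : ℕ} (m : ℕ) (G : SimpleGraph (Fin k)) (π : Fin n → Fin k) : Type :=
  List (Gate m G π)

namespace Circuit

variable {n k m : ℕ} {G : SimpleGraph (Fin k)} {π : Fin n → Fin k}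

/-- The operator computed by a circuit. -/
def toMatrix : Circuit m G π → Matrix (Qubit n k m → Bool) (Qubit n k m → Bool) ℂ
  | [] => 1
  | g :: T => toMatrix T * g.toMatrix

/-- The number of nonlocal two-qubit gates of a circuit. -/
def numNonlocal (T : Circuit m G π) : ℕ :=
  (T.map Gate.cost).sum

end Circuit

/-- The vector `ψ ⊗ |0…0⟩`: data register in `ψ`, all ancillas in `|0⟩`. -/
def withAncillas {n : ℕ} (k m : ℕ) (ψ : (Fin n → Bool) → ℂ) : (Qubit n k m → Bool) → ℂ :=
  fun z => if ∀ a, z (Sum.inr a) = false then ψ (fun i => z (Sum.inl i)) else 0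

/-- The circuit `T` implements `U` exactly, with clean ancillas:
`T (ψ ⊗ |0…0⟩) = (U ψ) ⊗ |0…0⟩` for every `ψ`. -/
def Circuit.Implements {n k m : ℕ} {G : SimpleGraph (Fin k)} {π : Fin n → Fin k}
    (T : Circuit m G π) (U : QubitUnitary (Fin n)) : Prop :=
  ∀ ψ : (Fin n → Bool) → ℂ,
    T.toMatrix.mulVec (withAncillas k m ψ) = withAncillas k m (U.1.mulVec ψ)

/-- The minimum number of nonlocal two-qubit gates needed to implement `U` over the topology `G`
with `m` ancillas per processor, when processor `i` holds the data qubits in `π ⁻¹ {i}`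
(it is `⊤` if no circuit implements `U`). -/
noncomputable def commComplexityOf {n k : ℕ} (m : ℕ) (G : SimpleGraph (Fin k)) (π : Fin n → Fin k)
    (U : QubitUnitary (Fin n)) : ℕ∞ :=
  ⨅ (T : Circuit m G π) (_ : T.Implements U), (T.numNonlocal : ℕ∞)

/-- The partition `π` of `n` data qubits among `k` processors is balanced with slack `b`: every
processor holds `n / k` data qubits up to an error of less than `b`. -/
def Balanced {n k : ℕ} (b : ℝ) (π : Fin n → Fin k) : Prop :=
  ∀ i : Fin k, |((Finset.univ.filter fun j => π j = i).card : ℝ) - (n : ℝ) / (k : ℝ)| < b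

/-- The communication complexity of `U` over the topology `G` with `m` ancillas per processor,
optimized over all partitions of the data qubits that are balanced with slack `b`. -/
noncomputable def graphCommComplexity {n k : ℕ} (b : ℝ) (m : ℕ) (G : SimpleGraph (Fin k))
    (U : QubitUnitary (Fin n)) : ℕ∞ :=
  ⨅ (π : Fin n → Fin k) (_ : Balanced b π), commComplexityOf m G π U

/-- The `k`-party communication complexity of `U`: the processors are pairwise connected. -/
noncomputable def commComplexity {n : ℕ} (b : ℝ) (k m : ℕ) (U : QubitUnitary (Fin n)) : ℕ∞ :=
  graphCommComplexity b m (⊤ : SimpleGraph (Fin k)) U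

/-- The quantity `max {4 ^ ((1 - 1/k) n - m), n}`. -/
noncomputable def commBound (n k m : ℕ) : ℝ :=
  max ((4 : ℝ) ^ ((1 - 1 / (k : ℝ)) * (n : ℝ) - (m : ℝ))) (n : ℝ)

end DistQC

/-!
The order of growth is that of the number of free parameters. Fix the processor that holds the most
data. Moving `m` further data qubits into its ancillas leaves about `a = (1 - 1/k) n - m` data
qubits outside, and the unitaries on everything else are free.

*Upper bound.* A unitary on that processor and `a` further qubits is a `2 × 2` block matrix over the
value of one of these qubits. The cosine-sine decomposition, with its block-diagonal factors
demultiplexed by the spectral theorem (`exists_shannon`), writes it as a product of four unitaries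
on one qubit less, three diagonal unitaries and two single-qubit gates. A diagonal unitary reduces
to three diagonal unitaries on one qubit less (`achievable_phase`), hence costs `O(3 ^ a)`, and the
recursion `f (a + 1) = 4 f a + O(3 ^ a)` gives `O(4 ^ a)` nonlocal gates (`achievable_unitary`). The
swaps in and out of the ancillas cost at most `2 n` (`achievable_of_free_qubits`).

*Lower bound.* A set of matrices that is a countable union of `C¹` images of `ℝ ^ d` has Hausdorff
dimension at most `d`, whereas the unitary matrices of size `2 ^ n` have dimension `4 ^ n`: their
anti-Hermitian parts fill out, up to scaling, all anti-Hermitian matrices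
(`exists_unitary_notMem`). This is applied twice.

* Each nonlocal gate needs only one local gate on either of its processors, since local gates
  commute past everything on other processors (`exists_normalForm`). Processors without data that
  take part in no nonlocal gate contribute a scalar (`exists_word`), so `r` nonlocal gates leave
  `O((r + n) 4 ^ (n/k + m))` parameters, whatever `k` is. This is the exponential bound, up to an
  additive `n`.
* Some union of processors holds between about a quarter and three quarters of the data
  (`exists_cut`). Across this cut a circuit with `r` nonlocal gates has Schmidt rank at most `4 ^ r`
  (`schmidtRankLE_toMatrix`), and operators of that rank have only `O(4 ^ (r + 3n/4))` parameters.
  This is the bound linear in `n`, which holds for any number of ancillas.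
-/

namespace DistQC

open Matrix

/-! ### Operators on a set of qubits -/

section Operators

variable {Q : Type} [DecidableEq Q]

/-- The basis state that has the bits `u` on `S` and agrees with `y` off `S`. -/
def overwrite (S : Finset Q) (u : S → Bool) (y : Q → Bool) : Q → Bool :=
  fun q => if h : q ∈ S then u ⟨q, h⟩ else y q

lemma overwrite_mem (S : Finset Q) (u : S → Bool) (y : Q → Bool) (q : S) :
    overwrite S u y q = u q := by
  simp [overwrite]

lemma overwrite_notMem (S : Finset Q) (u : S → Bool) (y : Q → Bool) {q : Q} (hq : q ∉ S) :
    overwrite S u y q = y q := by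
  simp [overwrite, hq]

lemma overwrite_restrict (S : Finset Q) (x y : Q → Bool) (h : ∀ q, q ∉ S → x q = y q) :
    overwrite S (fun q => x q) y = x := by
  funext q
  by_cases hq : q ∈ S
  · simp [overwrite, hq]
  · simp [overwrite, hq, h q hq]

variable [Fintype Q]

lemma onQubits_apply (S : Finset Q) (V : Matrix (S → Bool) (S → Bool) ℂ) (x y : Q → Bool) :
    onQubits S V x y =
      if ∀ q, q ∉ S → x q = y q then V (fun q => x q) (fun q => y q) else 0 := rfl

lemma onQubits_mul (S : Finset Q) (V W : Matrix (S → Bool) (S → Bool) ℂ) :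
    onQubits S (V * W) = onQubits S V * onQubits S W := by
  ext x y
  rw [Matrix.mul_apply, onQubits_apply]
  split_ifs with h
  · rw [Matrix.mul_apply]
    refine Finset.sum_of_injOn (fun u => overwrite S u y) ?_ (by simp) ?_ ?_
    · intro u _ v _ huv
      funext q
      simpa [overwrite_mem] using congrFun huv q
    · intro z _ hz
      have hzy : ¬ ∀ q, q ∉ S → z q = y q := by
        intro hzy
        exact hz ⟨fun q => z q, by simp, overwrite_restrict S z y hzy⟩
      rw [onQubits_apply S W, if_neg hzy, mul_zero]
    · intro u _
      rw [onQubits_apply, onQubits_apply, if_pos, if_pos]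
      · simp [overwrite_mem]
      · intro q hq
        simp [overwrite_notMem S u y hq]
      · intro q hq
        simp [overwrite_notMem S u y hq, h q hq]
  · symm
    refine Finset.sum_eq_zero fun z _ => ?_
    rw [onQubits_apply, onQubits_apply]
    split_ifs with h1 h2
    · exact absurd (fun q hq => (h1 q hq).trans (h2 q hq)) h
    all_goals simp

lemma onQubits_one (S : Finset Q) : onQubits S (1 : Matrix (S → Bool) (S → Bool) ℂ) = 1 := by
  ext x y
  rw [onQubits_apply]
  by_cases hxy : x = y
  · subst hxy; simp
  · rw [Matrix.one_apply_ne hxy]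
    split_ifs with h
    · rw [Matrix.one_apply_ne]
      intro hS
      refine hxy (funext fun q => ?_)
      by_cases hq : q ∈ S
      · exact congrFun hS ⟨q, hq⟩
      · exact h q hq
    · rfl

lemma onQubits_conjTranspose (S : Finset Q) (V : Matrix (S → Bool) (S → Bool) ℂ) :
    onQubits S Vᴴ = (onQubits S V)ᴴ := by
  ext x y
  rw [Matrix.conjTranspose_apply, onQubits_apply, onQubits_apply]
  simp only [eq_comm (a := x _), Matrix.conjTranspose_apply]
  split_ifs <;> simp

lemma onQubits_injective (S : Finset Q) :
    Function.Injective (onQubits S : Matrix (S → Bool) (S → Bool) ℂ → _) := by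
  intro V W h
  ext u v
  have := congrFun (congrFun h (overwrite S u fun _ => false)) (overwrite S v fun _ => false)
  rw [onQubits_apply, onQubits_apply, if_pos, if_pos] at this
  · simpa [overwrite_mem] using this
  all_goals
    intro q hq
    simp [overwrite_notMem S _ _ hq]

/-- The product of an operator on `S` and an operator on the complementary qubits is their tensor
product. -/
lemma onQubits_mul_onQubits_compl (S : Finset Q) (V : Matrix (S → Bool) (S → Bool) ℂ)
    (W : Matrix ((Sᶜ : Finset Q) → Bool) ((Sᶜ : Finset Q) → Bool) ℂ) (x y : Q → Bool) :
    (onQubits S V * onQubits Sᶜ W) x y =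
      V (fun q => x q) (fun q => y q) * W (fun q => x q) (fun q => y q) := by
  rw [Matrix.mul_apply, Finset.sum_eq_single (overwrite S (fun q => y q) x)]
  · rw [onQubits_apply, onQubits_apply, if_pos, if_pos]
    · congr 2
      · simp [overwrite_mem]
      · funext q
        rw [overwrite_notMem _ _ _ (Finset.mem_compl.1 q.2)]
    · intro q hq
      have hq : q ∈ S := by simpa using hq
      exact overwrite_mem S _ _ ⟨q, hq⟩
    · intro q hq
      rw [overwrite_notMem S _ _ hq]
  · intro z _ hz
    rw [onQubits_apply, onQubits_apply]
    split_ifs with h1 h2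
    · refine absurd (funext fun q => ?_) hz
      by_cases hq : q ∈ S
      · rw [h2 q (by simpa using hq), overwrite_mem S _ _ ⟨q, hq⟩]
      · rw [overwrite_notMem S _ _ hq, h1 q hq]
    all_goals simp
  · simp

lemma onQubits_compl_mul_onQubits (S : Finset Q) (V : Matrix (S → Bool) (S → Bool) ℂ)
    (W : Matrix ((Sᶜ : Finset Q) → Bool) ((Sᶜ : Finset Q) → Bool) ℂ) (x y : Q → Bool) :
    (onQubits Sᶜ W * onQubits S V) x y =
      V (fun q => x q) (fun q => y q) * W (fun q => x q) (fun q => y q) := by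
  rw [Matrix.mul_apply, Finset.sum_eq_single (overwrite S (fun q => x q) y)]
  · rw [onQubits_apply, onQubits_apply, if_pos, if_pos, mul_comm]
    · congr 2
      · simp [overwrite_mem]
      · funext q
        rw [overwrite_notMem _ _ _ (Finset.mem_compl.1 q.2)]
    · intro q hq
      rw [overwrite_notMem S _ _ hq]
    · intro q hq
      have hq : q ∈ S := by simpa using hq
      exact (overwrite_mem S (fun q => x q) y ⟨q, hq⟩).symm
  · intro z _ hz
    rw [onQubits_apply, onQubits_apply]
    split_ifs with h1 h2
    · refine absurd (funext fun q => ?_) hz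
      by_cases hq : q ∈ S
      · rw [← h1 q (by simpa using hq), overwrite_mem S _ _ ⟨q, hq⟩]
      · rw [overwrite_notMem S _ _ hq, h2 q hq]
    all_goals simp
  · simp

/-- The operator `M` has the form `V ⊗ I` with `V` acting on the qubits in `S`. -/
def SupportedOn (S : Finset Q) (M : Matrix (Q → Bool) (Q → Bool) ℂ) : Prop :=
  ∃ V, onQubits S V = M

lemma supportedOn_onQubits (S : Finset Q) (V : Matrix (S → Bool) (S → Bool) ℂ) :
    SupportedOn S (onQubits S V) := ⟨V, rfl⟩

/-- Support is visible in the entries: they vanish unless row and column agree off `S`, and do not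
depend on the common bits off `S`. -/
lemma supportedOn_of_apply {S : Finset Q} {M : Matrix (Q → Bool) (Q → Bool) ℂ}
    (h0 : ∀ x y, (∃ q, q ∉ S ∧ x q ≠ y q) → M x y = 0)
    (h1 : ∀ x y x' y' : Q → Bool, (∀ q, q ∉ S → x q = y q) → (∀ q, q ∉ S → x' q = y' q) →
      (∀ q ∈ S, x q = x' q) → (∀ q ∈ S, y q = y' q) → M x y = M x' y') :
    SupportedOn S M := by
  refine ⟨Matrix.of fun u v => M (overwrite S u fun _ => false) (overwrite S v fun _ => false), ?_⟩
  ext x y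
  rw [onQubits_apply]
  split_ifs with h
  · refine h1 _ _ _ _ ?_ h ?_ ?_
    · intro q hq
      simp [overwrite_notMem S _ _ hq]
    · intro q hq
      exact overwrite_mem S _ _ ⟨q, hq⟩
    · intro q hq
      exact overwrite_mem S _ _ ⟨q, hq⟩
  · push Not at h
    exact (h0 x y h).symm

lemma SupportedOn.apply_eq_zero {S : Finset Q} {M : Matrix (Q → Bool) (Q → Bool) ℂ}
    (h : SupportedOn S M) {x y : Q → Bool} {q : Q} (hq : q ∉ S) (hxy : x q ≠ y q) :
    M x y = 0 := by
  obtain ⟨V, rfl⟩ := h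
  rw [onQubits_apply, if_neg]
  exact fun H => hxy (H q hq)

lemma SupportedOn.apply_congr {S : Finset Q} {M : Matrix (Q → Bool) (Q → Bool) ℂ}
    (h : SupportedOn S M) {x y x' y' : Q → Bool} (hxy : ∀ q, q ∉ S → x q = y q)
    (hxy' : ∀ q, q ∉ S → x' q = y' q) (hx : ∀ q ∈ S, x q = x' q) (hy : ∀ q ∈ S, y q = y' q) :
    M x y = M x' y' := by
  obtain ⟨V, rfl⟩ := h
  rw [onQubits_apply, onQubits_apply, if_pos hxy, if_pos hxy']
  congr 1
  · funext q; exact hx q q.2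
  · funext q; exact hy q q.2

lemma SupportedOn.mono {S T : Finset Q} (hST : S ⊆ T) {M : Matrix (Q → Bool) (Q → Bool) ℂ}
    (h : SupportedOn S M) : SupportedOn T M := by
  refine supportedOn_of_apply ?_ ?_
  · rintro x y ⟨q, hq, hxy⟩
    exact h.apply_eq_zero (fun hS => hq (hST hS)) hxy
  · intro x y x' y' hxy hxy' hx hy
    by_cases hS : ∀ q, q ∉ S → x q = y q
    · refine h.apply_congr hS (fun q hq => ?_) (fun q hq => hx q (hST hq)) fun q hq => hy q (hST hq)
      by_cases hT : q ∈ T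
      · rw [← hx q hT, ← hy q hT, hS q hq]
      · exact hxy' q hT
    · push Not at hS
      obtain ⟨q, hq, hne⟩ := hS
      have hT : q ∈ T := by
        by_contra hT
        exact hne (hxy q hT)
      rw [h.apply_eq_zero hq hne, h.apply_eq_zero hq]
      rwa [← hx q hT, ← hy q hT]

/-- Operators on disjoint sets of qubits commute. -/
lemma SupportedOn.commute {S T : Finset Q} (hST : Disjoint S T)
    {M N : Matrix (Q → Bool) (Q → Bool) ℂ} (hM : SupportedOn S M) (hN : SupportedOn T N) :
    Commute M N := by
  obtain ⟨V, rfl⟩ := hM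
  have hT : T ⊆ Sᶜ := fun q hq => Finset.mem_compl.2 (Finset.disjoint_right.1 hST hq)
  obtain ⟨W, rfl⟩ := hN.mono hT
  ext x y
  rw [onQubits_mul_onQubits_compl, onQubits_compl_mul_onQubits]

lemma onQubits_mem_unitary {S : Finset Q} (V : QubitUnitary S) :
    onQubits S V.1 ∈ Matrix.unitaryGroup (Q → Bool) ℂ := by
  rw [Matrix.mem_unitaryGroup_iff, star_eq_conjTranspose, ← onQubits_conjTranspose,
    ← onQubits_mul, ← star_eq_conjTranspose, Matrix.mem_unitaryGroup_iff.1 V.2, onQubits_one]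

lemma SupportedOn.exists_unitary {S : Finset Q} {M : Matrix (Q → Bool) (Q → Bool) ℂ}
    (h : SupportedOn S M) (hM : M ∈ Matrix.unitaryGroup (Q → Bool) ℂ) :
    ∃ V : QubitUnitary S, onQubits S V.1 = M := by
  obtain ⟨V, rfl⟩ := h
  refine ⟨⟨V, ?_⟩, rfl⟩
  rw [Matrix.mem_unitaryGroup_iff] at hM ⊢
  apply onQubits_injective S
  rw [onQubits_mul, star_eq_conjTranspose, onQubits_conjTranspose, ← star_eq_conjTranspose, hM,
    onQubits_one]

end Operators

/-! ### The cosine-sine decomposition -/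

section CosineSine

variable {N : Type} [Fintype N] [DecidableEq N]

/-- A matrix with orthogonal columns of lengths `d j` is a unitary times `diagonal d`, also when
some columns vanish. -/
lemma exists_unitary_mul_diagonal (M : Matrix N N ℂ) (d : N → ℝ)
    (h : Mᴴ * M = diagonal fun j => ((d j : ℂ)) ^ 2) :
    ∃ V ∈ unitaryGroup N ℂ, M = V * diagonal fun j => (d j : ℂ) := by
  have hentry : ∀ i j, ∑ l, star (M l i) * M l j = if i = j then (d i : ℂ) ^ 2 else 0 := by
    intro i j
    have := congrFun (congrFun h i) j
    simpa [Matrix.mul_apply, diagonal_apply] using this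
  let v : N → EuclideanSpace ℂ N := fun j => WithLp.toLp 2 fun l => (d j : ℂ)⁻¹ * M l j
  have hv : Orthonormal ℂ (({j | d j ≠ 0} : Set N).domRestrict v) := by
    rw [orthonormal_iff_ite]
    rintro ⟨i, hi⟩ ⟨j, hj⟩
    have hi' : (d i : ℂ) ≠ 0 := by exact_mod_cast hi
    have : inner ℂ (v i) (v j) = (d i : ℂ)⁻¹ * (d j : ℂ)⁻¹ * ∑ l, star (M l i) * M l j := by
      simp only [v, PiLp.inner_apply, RCLike.inner_apply, Finset.mul_sum, map_mul, map_inv₀,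
        Complex.conj_ofReal]
      refine Finset.sum_congr rfl fun l _ => ?_
      simp only [RCLike.star_def]
      ring
    rw [Set.domRestrict_apply, Set.domRestrict_apply, this, hentry]
    simp only [Subtype.mk.injEq]
    split_ifs with hij
    · subst hij; field_simp
    · simp
  obtain ⟨b, hb⟩ := hv.exists_orthonormalBasis_extension_of_card_eq (by simp)
  refine ⟨(EuclideanSpace.basisFun N ℂ).toBasis.toMatrix b.toBasis,
    (EuclideanSpace.basisFun N ℂ).toMatrix_orthonormalBasis_mem_unitary b, ?_⟩
  ext i j
  rw [mul_diagonal]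
  simp only [Module.Basis.toMatrix_apply, OrthonormalBasis.coe_toBasis,
    OrthonormalBasis.coe_toBasis_repr_apply, EuclideanSpace.basisFun_repr]
  by_cases hj : d j = 0
  · have h0 := hentry j j
    rw [if_pos rfl, hj] at h0
    have h1 : ∑ l, Complex.normSq (M l j) = 0 := by
      have : ((∑ l, Complex.normSq (M l j) : ℝ) : ℂ) = 0 := by
        rw [Complex.ofReal_sum, ← sq_eq_zero_iff.2 (Complex.ofReal_zero), ← h0]
        refine Finset.sum_congr rfl fun l _ => ?_
        rw [Complex.normSq_eq_conj_mul_self]; rfl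
      exact_mod_cast this
    rw [Finset.sum_eq_zero_iff_of_nonneg fun l _ => Complex.normSq_nonneg _] at h1
    have := Complex.normSq_eq_zero.1 (h1 i (Finset.mem_univ _))
    simp [this, hj]
  · have hj' : (d j : ℂ) ≠ 0 := by exact_mod_cast hj
    rw [hb j hj]
    simp only [v]
    field_simp

/-- The pole of a Cayley transform can be put on the unit circle off the spectrum. -/
lemma exists_unit_det_ne_zero (L : Matrix N N ℂ) :
    ∃ w : ℂ, star w * w = 1 ∧ IsUnit (w • (1 : Matrix N N ℂ) + L) := by
  have hfin : ((fun z : Circle => (-z : ℂ)) ⁻¹' spectrum ℂ L).Finite :=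
    (Matrix.finite_spectrum L).preimage
      (Function.Injective.injOn fun a b hab => Circle.coe_injective (by simpa using hab))
  have : Infinite (Set.Ioc (-Real.pi) Real.pi) :=
    (Set.Ioc_infinite (by linarith [Real.pi_pos])).to_subtype
  have : Infinite Circle := by
    refine Infinite.of_injective (fun x : Set.Ioc (-Real.pi) Real.pi => Circle.exp x) ?_
    intro x y hxy
    have := congrArg (fun z : Circle => Complex.arg z) hxy
    simp only [Circle.arg_exp x.2.1 x.2.2, Circle.arg_exp y.2.1 y.2.2] at this
    exact Subtype.ext this
  obtain ⟨z, hz⟩ := hfin.exists_notMem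
  refine ⟨z, ?_, ?_⟩
  · have := Circle.normSq_coe z
    rw [Complex.star_def, ← Complex.normSq_eq_conj_mul_self, this, Complex.ofReal_one]
  · have : -(z : ℂ) ∉ spectrum ℂ L := hz
    rw [spectrum.notMem_iff] at this
    have h2 := this.neg
    convert h2 using 1
    simp [Algebra.algebraMap_eq_smul_one, add_comm]

/-- Spectral theorem for unitary matrices, from the Hermitian one by a Cayley transform. -/
lemma exists_diagonalization (L : Matrix N N ℂ) (hL : L ∈ unitaryGroup N ℂ) :
    ∃ V ∈ unitaryGroup N ℂ, ∃ θ : N → ℝ,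
      L = V * diagonal (fun j => Complex.exp (θ j * Complex.I)) * Vᴴ := by
  obtain ⟨w, hw, hu⟩ := exists_unit_det_ne_zero L
  have hLL' : Lᴴ * L = 1 := mem_unitaryGroup_iff'.1 hL
  obtain ⟨G, hG⟩ := hu.exists_right_inv
  have hG' : G * (w • (1 : Matrix N N ℂ) + L) = 1 := mul_eq_one_comm.1 hG
  set P := w • (1 : Matrix N N ℂ) + L with hP
  -- The Cayley transform `H = i (w - L) (w + L)⁻¹` is Hermitian, and `L = w (1 + i H) / (1 - i H)`.
  set H := Complex.I • ((w • (1 : Matrix N N ℂ) - L) * G) with hH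
  have hLP : L * P = P * L := by simp [hP, mul_add, add_mul]
  have hLG : L * G = G * L := by
    calc L * G = G * P * L * G := by rw [hG', one_mul]
      _ = G * (L * P) * G := by rw [hLP]; simp only [mul_assoc]
      _ = G * L := by rw [mul_assoc, mul_assoc, hG, mul_one]
  have hPs : Pᴴ = star w • (Lᴴ * P) := by
    rw [hP, mul_add, hLL', conjTranspose_add, conjTranspose_smul, conjTranspose_one, mul_smul_comm,
      mul_one, smul_add, smul_smul, hw, one_smul, add_comm]
  have hMs : (w • (1 : Matrix N N ℂ) - L)ᴴ = - (star w • (Lᴴ * (w • (1 : Matrix N N ℂ) - L))) := by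
    rw [mul_sub, hLL', conjTranspose_sub, conjTranspose_smul, conjTranspose_one, mul_smul_comm,
      mul_one, smul_sub, smul_smul, hw, one_smul, neg_sub]
  have hGs : star w • (Gᴴ * Lᴴ) = G := by
    have h1 : Gᴴ * Pᴴ = 1 := by rw [← conjTranspose_mul, hG, conjTranspose_one]
    have h2 := congrArg (· * G) h1
    simpa [hPs, mul_assoc, hG] using h2
  have hherm : H.IsHermitian := by
    have hcomm : (w • (1 : Matrix N N ℂ) - L) * G = G * (w • (1 : Matrix N N ℂ) - L) := by
      rw [sub_mul, mul_sub, hLG, smul_mul_assoc, mul_smul_comm, one_mul, mul_one]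
    have : Hᴴ = Complex.I • ((star w • (Gᴴ * Lᴴ)) * (w • (1 : Matrix N N ℂ) - L)) := by
      rw [hH, conjTranspose_smul, conjTranspose_mul, hMs]
      simp [mul_assoc]
    rw [Matrix.IsHermitian, this, hGs, hH, hcomm]
  have hIH : Complex.I • H = - ((w • (1 : Matrix N N ℂ) - L) * G) := by
    rw [hH, smul_smul, Complex.I_mul_I, neg_one_smul]
  have hkey : L * (1 - Complex.I • H) = w • (1 + Complex.I • H) := by
    have e1 : 1 - Complex.I • H = (2 * w) • G := by
      have : 1 - Complex.I • H = (P + (w • (1 : Matrix N N ℂ) - L)) * G := by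
        rw [hIH, add_mul, hG, sub_neg_eq_add]
      rw [this, hP, show w • (1 : Matrix N N ℂ) + L + (w • 1 - L) = (2 * w) • 1 by
        rw [two_mul, add_smul]; abel, smul_mul_assoc, one_mul]
    have e2 : 1 + Complex.I • H = (2 : ℂ) • (L * G) := by
      have : 1 + Complex.I • H = (P - (w • (1 : Matrix N N ℂ) - L)) * G := by
        rw [hIH, sub_mul P, hG, ← sub_eq_add_neg]
      rw [this, hP, show w • (1 : Matrix N N ℂ) + L - (w • 1 - L) = (2 : ℂ) • L by
        rw [two_smul]; abel, smul_mul_assoc]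
    rw [e1, e2, mul_smul_comm, smul_smul, mul_comm]
  clear_value H
  set V : Matrix N N ℂ := hherm.eigenvectorUnitary.1 with hV
  have hVm : V ∈ unitaryGroup N ℂ := hherm.eigenvectorUnitary.2
  have hVV : V * Vᴴ = 1 := mem_unitaryGroup_iff.1 hVm
  have hVV' : Vᴴ * V = 1 := mem_unitaryGroup_iff'.1 hVm
  set x := hherm.eigenvalues
  have hHV : H * V = V * diagonal fun j => (x j : ℂ) := by
    have h1 := hherm.spectral_theorem
    rw [Unitary.conjStarAlgAut_apply] at h1
    conv_lhs => rw [h1]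
    change V * _ * Vᴴ * V = _
    rw [mul_assoc, hVV', mul_one]
    rfl
  have hne : ∀ j, 1 - Complex.I * (x j : ℂ) ≠ 0 := by
    intro j h0
    have := congrArg Complex.re h0
    simp at this
  let D : N → ℂ := fun j => w * (1 + Complex.I * x j) * (1 - Complex.I * x j)⁻¹
  have hD : ∀ j, D j = Complex.exp ((D j).arg * Complex.I) := by
    intro j
    have hw1 : ‖w‖ = 1 := by
      have : Complex.normSq w = 1 := by
        have : ((Complex.normSq w : ℝ) : ℂ) = 1 := by
          rw [Complex.normSq_eq_conj_mul_self]; exact hw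
        exact_mod_cast this
      rw [Complex.norm_def, this, Real.sqrt_one]
    have hc : ‖1 + Complex.I * (x j : ℂ)‖ = ‖1 - Complex.I * (x j : ℂ)‖ := by
      rw [← Complex.norm_conj]
      simp [sub_eq_add_neg]
    have h1 : ‖D j‖ = 1 := by
      simp only [D, norm_mul, norm_inv, hw1, hc, one_mul]
      exact mul_inv_cancel₀ (norm_ne_zero_iff.2 (hne j))
    have := Complex.norm_mul_exp_arg_mul_I (D j)
    rw [h1] at this
    simpa using this.symm
  refine ⟨V, hVm, fun j => (D j).arg, ?_⟩
  simp only [← hD]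
  have h1 : L * V * diagonal (fun j => 1 - Complex.I * (x j : ℂ)) =
      V * diagonal D * diagonal fun j => 1 - Complex.I * (x j : ℂ) := by
    have hd1 : diagonal (fun j => 1 - Complex.I * (x j : ℂ)) =
        1 - Complex.I • diagonal fun j => (x j : ℂ) := by
      rw [← diagonal_one, ← diagonal_smul, diagonal_sub]; rfl
    have hd2 : diagonal D * diagonal (fun j => 1 - Complex.I * (x j : ℂ)) =
        w • (1 + Complex.I • diagonal fun j => (x j : ℂ)) := by
      rw [diagonal_mul_diagonal, ← diagonal_one, ← diagonal_smul, diagonal_add, ← diagonal_smul]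
      congr 1
      funext j
      simp only [D, inv_mul_cancel_right₀ (hne j)]
      simp
    rw [mul_assoc V, hd2, hd1]
    calc L * V * (1 - Complex.I • diagonal fun j => (x j : ℂ))
        = L * (1 - Complex.I • H) * V := by
          simp only [mul_sub, sub_mul, mul_one, mul_smul_comm, smul_mul_assoc, mul_assoc, hHV]
      _ = _ := by
          rw [hkey, smul_mul_assoc, add_mul, one_mul, smul_mul_assoc, hHV, mul_smul_comm, mul_add,
            mul_one, mul_smul_comm]
  have h2 := congrArg (fun Z => Z * diagonal (fun j => (1 - Complex.I * (x j : ℂ))⁻¹) * Vᴴ) h1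
  have hinv : diagonal (fun j => 1 - Complex.I * (x j : ℂ)) *
      diagonal (fun j => (1 - Complex.I * (x j : ℂ))⁻¹) = 1 := by
    rw [diagonal_mul_diagonal, ← diagonal_one]
    congr 1
    funext j
    exact mul_inv_cancel₀ (hne j)
  simp only [mul_assoc _ _ (diagonal fun j => (1 - Complex.I * (x j : ℂ))⁻¹), hinv, mul_one] at h2
  rw [← h2, mul_assoc, hVV, mul_one]

/-- Demultiplexing: a block-diagonal unitary is a diagonal unitary between two unitaries that act
equally on both blocks. -/
lemma exists_demultiplex (L₁ L₂ : Matrix N N ℂ) (h₁ : L₁ ∈ unitaryGroup N ℂ)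
    (h₂ : L₂ ∈ unitaryGroup N ℂ) :
    ∃ V ∈ unitaryGroup N ℂ, ∃ W ∈ unitaryGroup N ℂ, ∃ φ : N ⊕ N → ℝ,
      fromBlocks L₁ 0 0 L₂ = fromBlocks V 0 0 V *
        diagonal (fun j => Complex.exp (φ j * Complex.I)) * fromBlocks W 0 0 W := by
  obtain ⟨V, hV, θ, hθ⟩ := exists_diagonalization (L₁ * L₂ᴴ)
    (mul_mem h₁ (Unitary.star_mem h₂))
  have hVV : V * Vᴴ = 1 := mem_unitaryGroup_iff.1 hV
  have hLL : L₂ᴴ * L₂ = 1 := mem_unitaryGroup_iff'.1 h₂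
  let D : Matrix N N ℂ := diagonal fun j => Complex.exp (((θ j / 2 : ℝ) : ℂ) * Complex.I)
  let D' : Matrix N N ℂ := diagonal fun j => Complex.exp (((-(θ j / 2) : ℝ) : ℂ) * Complex.I)
  have hDD : D * D = diagonal fun j => Complex.exp (θ j * Complex.I) := by
    rw [diagonal_mul_diagonal]
    congr 1
    funext j
    rw [← Complex.exp_add]
    congr 1
    push_cast
    ring
  have hDD' : D' * D = 1 := by
    rw [diagonal_mul_diagonal, ← diagonal_one]
    congr 1
    funext j
    rw [← Complex.exp_add, ← Complex.exp_zero]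
    congr 1
    push_cast
    ring
  have hD : D ∈ unitaryGroup N ℂ := by
    rw [mem_unitaryGroup_iff', star_eq_conjTranspose, diagonal_conjTranspose, ← hDD']
    congr 2
    funext j
    rw [Pi.star_apply, Complex.star_def, ← Complex.exp_conj, map_mul, Complex.conj_ofReal,
      Complex.conj_I]
    congr 1
    push_cast
    ring
  refine ⟨V, hV, D * Vᴴ * L₂, mul_mem (mul_mem hD (Unitary.star_mem hV)) h₂,
    Sum.elim (fun j => θ j / 2) (fun j => -(θ j / 2)), ?_⟩
  have : diagonal (fun j : N ⊕ N => Complex.exp (((Sum.elim (fun j => θ j / 2)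
      (fun j => -(θ j / 2)) j : ℝ) : ℂ) * Complex.I)) = fromBlocks D 0 0 D' := by
    rw [fromBlocks_diagonal]
    congr 1
    funext j
    cases j <;> rfl
  rw [this, fromBlocks_multiply, fromBlocks_multiply]
  simp only [zero_mul, mul_zero, add_zero, zero_add]
  congr 1
  · calc L₁ = L₁ * L₂ᴴ * L₂ := by rw [mul_assoc, hLL, mul_one]
      _ = _ := by rw [hθ, ← hDD]; simp only [mul_assoc]
  · calc L₂ = V * (D' * D) * Vᴴ * L₂ := by rw [hDD', mul_one, hVV, one_mul]
      _ = _ := by simp only [mul_assoc]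

/-- The unitary `K` that conjugates a diagonal phase into a rotation of the two blocks; it acts only
on the bit that selects the block. -/
noncomputable def rotationFrame (N : Type) [DecidableEq N] : Matrix (N ⊕ N) (N ⊕ N) ℂ :=
  fromBlocks (((√2 : ℝ) : ℂ)⁻¹ • 1) (((√2 : ℝ) : ℂ)⁻¹ • 1)
    ((-Complex.I * ((√2 : ℝ) : ℂ)⁻¹) • 1) ((Complex.I * ((√2 : ℝ) : ℂ)⁻¹) • 1)

lemma sqrt_two_inv_mul_self : ((√2 : ℝ) : ℂ)⁻¹ * ((√2 : ℝ) : ℂ)⁻¹ = 1 / 2 := by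
  rw [← mul_inv, ← Complex.ofReal_mul, Real.mul_self_sqrt (by norm_num)]
  norm_num

lemma rotationFrame_mem : rotationFrame N ∈ unitaryGroup (N ⊕ N) ℂ := by
  have h := sqrt_two_inv_mul_self
  rw [mem_unitaryGroup_iff, star_eq_conjTranspose, rotationFrame, fromBlocks_conjTranspose,
    fromBlocks_multiply, ← fromBlocks_one]
  simp only [conjTranspose_smul, conjTranspose_one, smul_mul_smul_comm, mul_one, ← add_smul,
    Complex.star_def, map_mul, map_neg, map_inv₀, Complex.conj_ofReal, Complex.conj_I]
  congr 1
  · rw [h]; norm_num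
  · convert zero_smul ℂ (1 : Matrix N N ℂ) using 2; ring
  · convert zero_smul ℂ (1 : Matrix N N ℂ) using 2; ring
  · convert one_smul ℂ (1 : Matrix N N ℂ) using 2
    linear_combination (-2 * Complex.I * Complex.I) * h - Complex.I_mul_I

lemma rotationFrame_conj (θ : N → ℝ) :
    rotationFrame N * diagonal (fun j => Complex.exp
        (((Sum.elim θ (fun j => -θ j) j : ℝ) : ℂ) * Complex.I)) * (rotationFrame N)ᴴ =
      fromBlocks (diagonal fun j => (Real.cos (θ j) : ℂ)) (-diagonal fun j => (Real.sin (θ j) : ℂ))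
        (diagonal fun j => (Real.sin (θ j) : ℂ)) (diagonal fun j => (Real.cos (θ j) : ℂ)) := by
  have h := sqrt_two_inv_mul_self
  have : diagonal (fun j : N ⊕ N => Complex.exp
      (((Sum.elim θ (fun j => -θ j) j : ℝ) : ℂ) * Complex.I)) =
      fromBlocks (diagonal fun j => (Real.cos (θ j) : ℂ) + Real.sin (θ j) * Complex.I) 0 0
        (diagonal fun j => (Real.cos (θ j) : ℂ) - Real.sin (θ j) * Complex.I) := by
    rw [fromBlocks_diagonal]
    congr 1
    funext j
    cases j with
    | inl j => simp [Complex.exp_mul_I]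
    | inr j =>
      rw [Sum.elim_inr, Sum.elim_inr, Complex.exp_mul_I]
      push_cast
      rw [Complex.cos_neg, Complex.sin_neg]
      ring
  rw [this, rotationFrame, fromBlocks_conjTranspose, fromBlocks_multiply, fromBlocks_multiply]
  simp only [conjTranspose_smul, conjTranspose_one, mul_one, mul_zero,
    add_zero, zero_add, smul_mul_assoc, mul_smul_comm, one_mul, smul_smul, diagonal_neg,
    Complex.star_def, map_mul, map_neg, map_inv₀, Complex.conj_ofReal, Complex.conj_I]
  simp only [← diagonal_smul, diagonal_add]
  congr 2 <;> funext j <;> simp only [Pi.smul_apply, smul_eq_mul]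
  · linear_combination (2 * (Real.cos (θ j) : ℂ)) * h
  · linear_combination (2 * (Real.sin (θ j) : ℂ) * Complex.I * Complex.I) * h +
      (Real.sin (θ j) : ℂ) * Complex.I_mul_I
  · linear_combination (-2 * (Real.sin (θ j) : ℂ) * Complex.I * Complex.I) * h -
      (Real.sin (θ j) : ℂ) * Complex.I_mul_I
  · linear_combination (-2 * (Real.cos (θ j) : ℂ) * Complex.I * Complex.I) * h -
      (Real.cos (θ j) : ℂ) * Complex.I_mul_I

open scoped ComplexOrder in
/-- Cosine-sine decomposition of a unitary into `2 × 2` blocks. -/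
lemma exists_cosineSine (U : Matrix (N ⊕ N) (N ⊕ N) ℂ) (hU : U ∈ unitaryGroup (N ⊕ N) ℂ) :
    ∃ V₁ ∈ unitaryGroup N ℂ, ∃ V₂ ∈ unitaryGroup N ℂ, ∃ W₁ ∈ unitaryGroup N ℂ,
      ∃ W₂ ∈ unitaryGroup N ℂ, ∃ θ : N → ℝ,
      U = fromBlocks V₁ 0 0 V₂ *
        fromBlocks (diagonal fun j => (Real.cos (θ j) : ℂ))
          (-diagonal fun j => (Real.sin (θ j) : ℂ)) (diagonal fun j => (Real.sin (θ j) : ℂ))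
          (diagonal fun j => (Real.cos (θ j) : ℂ)) * fromBlocks W₁ 0 0 W₂ := by
  have hUU : Uᴴ * U = 1 := mem_unitaryGroup_iff'.1 hU
  obtain ⟨A, B, C, D, rfl⟩ : ∃ A B C D, U = fromBlocks A B C D :=
    ⟨_, _, _, _, (fromBlocks_toBlocks U).symm⟩
  have hAC : Aᴴ * A + Cᴴ * C = 1 := by
    have h := hUU
    rw [fromBlocks_conjTranspose, fromBlocks_multiply, ← fromBlocks_one] at h
    exact (fromBlocks_inj.1 h).1
  have hherm : (Aᴴ * A).IsHermitian := isHermitian_conjTranspose_mul_self A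
  set W : Matrix N N ℂ := hherm.eigenvectorUnitary.1 with hW
  have hWm : W ∈ unitaryGroup N ℂ := hherm.eigenvectorUnitary.2
  have hWW : W * Wᴴ = 1 := mem_unitaryGroup_iff.1 hWm
  have hWW' : Wᴴ * W = 1 := mem_unitaryGroup_iff'.1 hWm
  set x := hherm.eigenvalues with hx
  have hdiag : (A * W)ᴴ * (A * W) = diagonal fun j => (x j : ℂ) := by
    have h1 := hherm.conjStarAlgAut_star_eigenvectorUnitary
    rw [Unitary.conjStarAlgAut_star_apply] at h1
    rw [conjTranspose_mul]
    calc _ = Wᴴ * (Aᴴ * A) * W := by simp only [mul_assoc]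
      _ = _ := h1
  have hdiag' : (C * W)ᴴ * (C * W) = diagonal fun j => 1 - (x j : ℂ) := by
    have : (C * W)ᴴ * (C * W) = Wᴴ * W - (A * W)ᴴ * (A * W) := by
      rw [conjTranspose_mul, conjTranspose_mul]
      calc _ = Wᴴ * (Cᴴ * C) * W := by simp only [mul_assoc]
        _ = _ := by
          rw [eq_sub_of_add_eq' hAC]
          simp only [mul_sub, sub_mul, mul_one, mul_assoc]
    rw [this, hdiag, hWW', ← diagonal_one, diagonal_sub]
  have hx0 : ∀ j, 0 ≤ x j := by
    intro j
    exact (posSemidef_conjTranspose_mul_self A).eigenvalues_nonneg j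
  have hx1 : ∀ j, x j ≤ 1 := by
    intro j
    have h1 := (posSemidef_conjTranspose_mul_self (C * W)).diag_nonneg (i := j)
    rw [hdiag', diagonal_apply_eq] at h1
    have : (0 : ℂ) ≤ ((1 - x j : ℝ) : ℂ) := by simpa using h1
    have := Complex.zero_le_real.1 this
    linarith
  let θ : N → ℝ := fun j => Real.arccos √(x j)
  have hcos : ∀ j, Real.cos (θ j) = √(x j) := fun j =>
    Real.cos_arccos (by linarith [Real.sqrt_nonneg (x j)]) (Real.sqrt_le_one.2 (hx1 j))
  have hcos2 : ∀ j, (Real.cos (θ j) : ℂ) ^ 2 = x j := by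
    intro j
    rw [hcos, ← Complex.ofReal_pow, Real.sq_sqrt (hx0 j)]
  have hsin2 : ∀ j, (Real.sin (θ j) : ℂ) ^ 2 = 1 - x j := by
    intro j
    rw [← hcos2, ← Complex.ofReal_pow, Real.sin_sq]
    push_cast
    ring
  obtain ⟨V₁, hV₁, h₁⟩ := exists_unitary_mul_diagonal (A * W) (fun j => Real.cos (θ j))
    (by simp only [hdiag, hcos2])
  obtain ⟨V₂, hV₂, h₂⟩ := exists_unitary_mul_diagonal (C * W) (fun j => Real.sin (θ j))
    (by simp only [hdiag', hsin2])
  set c : Matrix N N ℂ := diagonal fun j => (Real.cos (θ j) : ℂ) with hc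
  set s : Matrix N N ℂ := diagonal fun j => (Real.sin (θ j) : ℂ) with hs
  have hcs : c * c + s * s = 1 := by
    rw [hc, hs, diagonal_mul_diagonal, diagonal_mul_diagonal, diagonal_add, ← diagonal_one]
    congr 1
    funext j
    rw [← pow_two, ← pow_two, hcos2, hsin2]
    ring
  have hcomm : s * c = c * s := by
    rw [hc, hs, diagonal_mul_diagonal, diagonal_mul_diagonal]
    simp only [mul_comm]
  have hcc : cᴴ = c := by
    rw [hc, diagonal_conjTranspose]
    congr 1
    funext j
    exact Complex.conj_ofReal _
  have hss : sᴴ = s := by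
    rw [hs, diagonal_conjTranspose]
    congr 1
    funext j
    exact Complex.conj_ofReal _
  have hV₁' : V₁ᴴ * V₁ = 1 := mem_unitaryGroup_iff'.1 hV₁
  have hV₂' : V₂ᴴ * V₂ = 1 := mem_unitaryGroup_iff'.1 hV₂
  have hV₁'' : V₁ * V₁ᴴ = 1 := mem_unitaryGroup_iff.1 hV₁
  have hV₂'' : V₂ * V₂ᴴ = 1 := mem_unitaryGroup_iff.1 hV₂
  set L := fromBlocks V₁ 0 0 V₂ with hL
  set R := fromBlocks c (-s) s c with hR
  set Z := fromBlocks W 0 0 (1 : Matrix N N ℂ) with hZ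
  have hLL : L * Lᴴ = 1 := by
    simp [hL, fromBlocks_conjTranspose, fromBlocks_multiply, hV₁'', hV₂'']
  have hZZ : Z * Zᴴ = 1 := by
    simp [hZ, fromBlocks_conjTranspose, fromBlocks_multiply, hWW]
  have hRR : R * Rᴴ = 1 := by
    simp [hR, fromBlocks_conjTranspose, fromBlocks_multiply, hcc, hss, hcs, hcomm, add_comm (s * s)]
  obtain ⟨X, hX⟩ : ∃ X, X = Rᴴ * Lᴴ * fromBlocks A B C D * Z := ⟨_, rfl⟩
  have hXX : Xᴴ * X = 1 := by
    have : X ∈ unitaryGroup (N ⊕ N) ℂ := by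
      rw [hX]
      exact mul_mem (mul_mem (mul_mem (Unitary.star_mem (mem_unitaryGroup_iff.2 hRR))
        (Unitary.star_mem (mem_unitaryGroup_iff.2 hLL))) hU) (mem_unitaryGroup_iff.2 hZZ)
    exact mem_unitaryGroup_iff'.1 this
  -- The first block column of `X` is `(1, 0)`, so unitarity makes `X` block diagonal.
  obtain ⟨E, F, hEF⟩ : ∃ E F, X = fromBlocks 1 E 0 F := by
    refine ⟨X.toBlocks₁₂, X.toBlocks₂₂, ?_⟩
    rw [← fromBlocks_toBlocks X]
    have h1 : Lᴴ * (fromBlocks A B C D * Z) = fromBlocks c (V₁ᴴ * B) s (V₂ᴴ * D) := by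
      rw [hL, hZ, fromBlocks_conjTranspose, fromBlocks_multiply, fromBlocks_multiply]
      simp [h₁, h₂, ← mul_assoc, hV₁', hV₂']
    have h2 : X = fromBlocks 1 (c * (V₁ᴴ * B) + s * (V₂ᴴ * D)) 0
        (-(s * (V₁ᴴ * B)) + c * (V₂ᴴ * D)) := by
      rw [hX, mul_assoc, mul_assoc, h1, hR, fromBlocks_conjTranspose, fromBlocks_multiply]
      simp [hcc, hss, hcs, hcomm]
    rw [h2]
    simp
  have hE : E = 0 ∧ Fᴴ * F = 1 := by
    rw [hEF, fromBlocks_conjTranspose, fromBlocks_multiply, ← fromBlocks_one] at hXX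
    have h := fromBlocks_inj.1 hXX
    have h1 : E = 0 := by simpa using h.2.1
    refine ⟨h1, ?_⟩
    simpa [h1] using h.2.2.2
  refine ⟨V₁, hV₁, V₂, hV₂, Wᴴ, Unitary.star_mem hWm, F, mem_unitaryGroup_iff'.2 hE.2, θ, ?_⟩
  have h3 : L * R * X * Zᴴ = fromBlocks A B C D := by
    rw [hX]
    calc _ = L * (R * Rᴴ) * Lᴴ * fromBlocks A B C D * (Z * Zᴴ) := by simp only [mul_assoc]
      _ = _ := by rw [hRR, hZZ, mul_one, mul_one, hLL, one_mul]
  rw [← h3, hEF, hE.1, hZ, mul_assoc, fromBlocks_conjTranspose, fromBlocks_multiply]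
  simp [fromBlocks_multiply]

/-- The diagonal unitary with entries `exp (i φ)`. -/
noncomputable def phase {ι : Type} [DecidableEq ι] (φ : ι → ℝ) : Matrix ι ι ℂ :=
  diagonal fun j => Complex.exp (φ j * Complex.I)

/-- The cosine-sine decomposition with its block-diagonal factors demultiplexed: four unitaries that
do not touch the bit that selects the block, three diagonal unitaries, and two unitaries on that
bit. -/
lemma exists_shannon (U : Matrix (N ⊕ N) (N ⊕ N) ℂ) (hU : U ∈ unitaryGroup (N ⊕ N) ℂ) :
    ∃ V₁ ∈ unitaryGroup N ℂ, ∃ W₁ ∈ unitaryGroup N ℂ, ∃ V₂ ∈ unitaryGroup N ℂ,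
      ∃ W₂ ∈ unitaryGroup N ℂ, ∃ φ₁ φ₂ φ₃ : N ⊕ N → ℝ,
      U = fromBlocks V₁ 0 0 V₁ * phase φ₁ * fromBlocks W₁ 0 0 W₁ *
        (rotationFrame N * phase φ₂ * (rotationFrame N)ᴴ) *
        (fromBlocks V₂ 0 0 V₂ * phase φ₃ * fromBlocks W₂ 0 0 W₂) := by
  obtain ⟨A, hA, B, hB, C, hC, D, hD, θ, h⟩ := exists_cosineSine U hU
  obtain ⟨V₁, hV₁, W₁, hW₁, φ₁, h₁⟩ := exists_demultiplex A B hA hB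
  obtain ⟨V₂, hV₂, W₂, hW₂, φ₃, h₃⟩ := exists_demultiplex C D hC hD
  refine ⟨V₁, hV₁, W₁, hW₁, V₂, hV₂, W₂, hW₂, φ₁, Sum.elim θ fun j => -θ j, φ₃, ?_⟩
  unfold phase
  rw [h, ← rotationFrame_conj, h₁, h₃]

end CosineSine

/-! ### Diagonal unitaries and permutation gates -/

section Phases

variable {ι : Type} [DecidableEq ι]

lemma phase_add [Fintype ι] (φ ψ : ι → ℝ) : phase (fun x => φ x + ψ x) = phase φ * phase ψ := by
  rw [phase, phase, phase, diagonal_mul_diagonal]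
  congr 1
  funext x
  rw [← Complex.exp_add]
  congr 1
  push_cast
  ring

lemma phase_mem_unitary [Fintype ι] (φ : ι → ℝ) : phase φ ∈ unitaryGroup ι ℂ := by
  rw [mem_unitaryGroup_iff, star_eq_conjTranspose, phase, diagonal_conjTranspose,
    diagonal_mul_diagonal, ← diagonal_one]
  congr 1
  funext x
  rw [Pi.star_apply, Complex.star_def, ← Complex.exp_conj, ← Complex.exp_add, map_mul,
    Complex.conj_ofReal, Complex.conj_I, mul_neg, add_neg_cancel, Complex.exp_zero]

variable {Q : Type} [DecidableEq Q]

/-- Exchanging the bits `p` and `q`. -/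
def swapBits (p q : Q) : Equiv.Perm (Q → Bool) :=
  Function.Involutive.toPerm (fun x => x ∘ Equiv.swap p q) fun x => by
    funext r; simp

/-- Adding the bit `p` to the bit `q` modulo `2`. -/
def cnot {p q : Q} (h : p ≠ q) : Equiv.Perm (Q → Bool) :=
  Function.Involutive.toPerm (fun x => Function.update x q (xor (x q) (x p))) fun x => by
    funext r
    by_cases hr : r = q
    · subst hr; simp [Function.update_of_ne h]
    · simp [hr]

lemma swapBits_apply (p q : Q) (x : Q → Bool) : swapBits p q x = x ∘ Equiv.swap p q := rfl

lemma cnot_apply {p q : Q} (h : p ≠ q) (x : Q → Bool) :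
    cnot h x = Function.update x q (xor (x q) (x p)) := rfl

lemma swapBits_symm (p q : Q) : (swapBits p q).symm = swapBits p q := rfl

lemma cnot_symm {p q : Q} (h : p ≠ q) : (cnot h).symm = cnot h := rfl

variable [Fintype Q]

lemma phase_supportedOn {S : Finset Q} {φ : (Q → Bool) → ℝ}
    (h : ∀ x y, (∀ q ∈ S, x q = y q) → φ x = φ y) : SupportedOn S (phase φ) := by
  refine supportedOn_of_apply ?_ ?_
  · rintro x y ⟨q, -, hq⟩
    exact diagonal_apply_ne _ fun h => hq (congrFun h q)
  · intro x y x' y' hxy hxy' hx hy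
    have hiff : x = y ↔ x' = y' := by
      constructor
      · rintro rfl
        funext q
        by_cases hq : q ∈ S
        · rw [← hx q hq, hy q hq]
        · exact hxy' q hq
      · rintro rfl
        funext q
        by_cases hq : q ∈ S
        · rw [hx q hq, hy q hq]
        · exact hxy q hq
    by_cases hxy : x = y
    · have h' := hiff.1 hxy
      subst hxy h'
      simp only [phase, diagonal_apply_eq, h x x' hx]
    · rw [phase, diagonal_apply_ne _ hxy, diagonal_apply_ne _ (mt hiff.2 hxy)]

/-- A permutation of the basis states that reads and writes only the bits in `S` is supported
on `S`. -/
lemma permMatrix_supportedOn {S : Finset Q} (τ : Equiv.Perm (Q → Bool))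
    (h : ∀ x q, q ∉ S → τ x q = x q)
    (h' : ∀ x y, (∀ q ∈ S, x q = y q) → ∀ q ∈ S, τ x q = τ y q) :
    SupportedOn S (τ.permMatrix ℂ) := by
  have happ : ∀ x y, τ.permMatrix ℂ x y = if τ x = y then 1 else 0 := by
    intro x y
    simp [Equiv.Perm.permMatrix, PEquiv.toMatrix_apply, eq_comm]
  refine supportedOn_of_apply ?_ ?_
  · rintro x y ⟨q, hq, hne⟩
    rw [happ, if_neg]
    rintro rfl
    exact hne (h x q hq).symm
  · have key : ∀ x y x' y' : Q → Bool, (∀ q, q ∉ S → x' q = y' q) →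
      (∀ q ∈ S, x q = x' q) → (∀ q ∈ S, y q = y' q) → τ x = y → τ x' = y' := by
      rintro x y x' y' hxy' hx hy rfl
      funext q
      by_cases hq : q ∈ S
      · rw [← hy q hq, h' x x' hx q hq]
      · rw [h _ _ hq, hxy' q hq]
    intro x y x' y' hxy hxy' hx hy
    rw [happ, happ]
    congr 1
    exact propext ⟨key x y x' y' hxy' hx hy,
      key x' y' x y hxy (fun q hq => (hx q hq).symm) fun q hq => (hy q hq).symm⟩

lemma permMatrix_mem_unitary (τ : Equiv.Perm (Q → Bool)) :
    τ.permMatrix ℂ ∈ unitaryGroup (Q → Bool) ℂ := by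
  rw [mem_unitaryGroup_iff, star_eq_conjTranspose, conjTranspose_permMatrix, ← permMatrix_mul]
  simp

lemma submatrix_mem_unitary {α β : Type} [Fintype α] [DecidableEq α] [Fintype β] [DecidableEq β]
    {M : Matrix α α ℂ} (hM : M ∈ unitaryGroup α ℂ) (e : β ≃ α) :
    M.submatrix e e ∈ unitaryGroup β ℂ := by
  rw [mem_unitaryGroup_iff, star_eq_conjTranspose, conjTranspose_submatrix, submatrix_mul_equiv,
    ← star_eq_conjTranspose, mem_unitaryGroup_iff.1 hM, submatrix_one_equiv]

lemma swapBits_supportedOn (p q : Q) : SupportedOn {p, q} ((swapBits p q).permMatrix ℂ) := by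
  refine permMatrix_supportedOn _ ?_ ?_
  · intro x r hr
    simp only [Finset.mem_insert, Finset.mem_singleton, not_or] at hr
    rw [swapBits_apply, Function.comp_apply, Equiv.swap_apply_of_ne_of_ne hr.1 hr.2]
  · intro x y h r hr
    simp only [Finset.mem_insert, Finset.mem_singleton] at hr h
    rcases hr with rfl | rfl <;> simp [swapBits_apply, h]

lemma cnot_supportedOn {p q : Q} (h : p ≠ q) : SupportedOn {p, q} ((cnot h).permMatrix ℂ) := by
  refine permMatrix_supportedOn _ ?_ ?_
  · intro x r hr
    simp only [Finset.mem_insert, Finset.mem_singleton, not_or] at hr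
    rw [cnot_apply, Function.update_of_ne hr.2]
  · intro x y h' r hr
    simp only [Finset.mem_insert, Finset.mem_singleton] at hr h'
    rcases hr with rfl | rfl
    · simp [cnot_apply, Function.update_of_ne h, h']
    · simp [cnot_apply, h']

end Phases

/-! ### Operators computed with few nonlocal gates -/

section Achievable

variable {n k m : ℕ}

/-- The operator `M` is computed by a circuit with at most `r` nonlocal gates, on pairwise connected
processors with the data qubits distributed by `π`. -/
def Achievable (π : Fin n → Fin k) (r : ℕ)
    (M : Matrix (Qubit n k m → Bool) (Qubit n k m → Bool) ℂ) : Prop :=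
  ∃ T : Circuit m (⊤ : SimpleGraph (Fin k)) π, T.toMatrix = M ∧ T.numNonlocal ≤ r

lemma Circuit.toMatrix_append {G : SimpleGraph (Fin k)} {π : Fin n → Fin k} (T T' : Circuit m G π) :
    Circuit.toMatrix (T ++ T') = T'.toMatrix * T.toMatrix := by
  induction T with
  | nil => simp [Circuit.toMatrix]
  | cons g T ih =>
    rw [List.cons_append, Circuit.toMatrix, Circuit.toMatrix, ih, mul_assoc]

variable {π : Fin n → Fin k} {r s : ℕ}
  {M M' : Matrix (Qubit n k m → Bool) (Qubit n k m → Bool) ℂ}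

lemma Achievable.mono (h : Achievable π r M) (hrs : r ≤ s) : Achievable π s M := by
  obtain ⟨T, hT, hr⟩ := h
  exact ⟨T, hT, hr.trans hrs⟩

lemma Achievable.mul (h : Achievable π r M) (h' : Achievable π s M') :
    Achievable π (r + s) (M * M') := by
  obtain ⟨T, rfl, hr⟩ := h
  obtain ⟨T', rfl, hs⟩ := h'
  refine ⟨T' ++ T, Circuit.toMatrix_append _ _, ?_⟩
  simp only [Circuit.numNonlocal, List.map_append, List.sum_append] at *
  lia

lemma mem_qubitsOf {i : Fin k} {q : Qubit n k m} : q ∈ qubitsOf m π i ↔ proc π q = i := by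
  simp [qubitsOf]

lemma achievable_local {i : Fin k} (h : SupportedOn (qubitsOf m π i) M)
    (hM : M ∈ unitaryGroup (Qubit n k m → Bool) ℂ) : Achievable π 0 M := by
  obtain ⟨V, rfl⟩ := h.exists_unitary hM
  refine ⟨[Gate.loc i V], ?_, by simp [Circuit.numNonlocal, Gate.cost]⟩
  simp [Circuit.toMatrix, Gate.toMatrix]

lemma achievable_two {p q : Qubit n k m} (h : SupportedOn {p, q} M)
    (hM : M ∈ unitaryGroup (Qubit n k m → Bool) ℂ) : Achievable π 1 M := by
  by_cases hpq : proc π p = proc π q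
  · refine (achievable_local (i := proc π q) (h.mono ?_) hM).mono zero_le_one
    intro r hr
    simp only [Finset.mem_insert, Finset.mem_singleton] at hr
    rcases hr with rfl | rfl
    · exact mem_qubitsOf.2 hpq
    · exact mem_qubitsOf.2 rfl
  · obtain ⟨V, rfl⟩ := h.exists_unitary hM
    refine ⟨[Gate.nonloc p q (by simpa using hpq) V], ?_, by simp [Circuit.numNonlocal, Gate.cost]⟩
    simp [Circuit.toMatrix, Gate.toMatrix]

/-- Conjugation by an involutive permutation gate on two qubits costs at most two nonlocal gates. -/
lemma Achievable.of_submatrix {τ : Equiv.Perm (Qubit n k m → Bool)} (hτ : τ.symm = τ)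
    {p q : Qubit n k m} (hs : SupportedOn {p, q} (τ.permMatrix ℂ))
    (h : Achievable π r (M.submatrix τ τ)) : Achievable π (r + 2) M := by
  have hP := achievable_two (π := π) hs (permMatrix_mem_unitary τ)
  have : M = τ.permMatrix ℂ * M.submatrix τ τ * τ.permMatrix ℂ := by
    rw [Equiv.Perm.permMatrix, PEquiv.toMatrix_toPEquiv_mul, PEquiv.mul_toMatrix_toPEquiv, hτ]
    ext x y
    have : ∀ z, τ (τ z) = z := fun z => by
      conv_lhs => rw [← hτ]
      rw [hτ]; nth_rw 1 [← hτ]; simp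
    simp [this]
  rw [this]
  exact ((hP.mul h).mul hP).mono (by lia)

end Achievable

/-! ### Synthesis of unitaries -/

section Synthesis

variable {n k m : ℕ} {π : Fin n → Fin k}

/-- Diagonal unitaries on one processor and a set `R` of further qubits. A function of two bits
`s, t` is a sum of functions of `s`, of `t` and of `s + t`; this removes one qubit of `R` at the
price of three diagonal unitaries, two of them conjugated by a two-qubit permutation gate. -/
lemma achievable_phase (i : Fin k) (b : Qubit n k m) (hb : proc π b = i)
    (R : Finset (Qubit n k m)) (hR : ∀ q ∈ R, proc π q ≠ i) :
    ∀ φ : (Qubit n k m → Bool) → ℝ,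
      (∀ x y, (∀ q ∈ R ∪ qubitsOf m π i, x q = y q) → φ x = φ y) →
      Achievable π (2 * 3 ^ R.card - 2) (phase φ) := by
  induction R using Finset.induction_on with
  | empty =>
    intro φ hφ
    exact achievable_local (i := i) (phase_supportedOn (by simpa using hφ)) (phase_mem_unitary φ)
  | insert a R ha ih =>
    intro φ hφ
    have ih := ih fun q hq => hR q (Finset.mem_insert_of_mem hq)
    have hab : a ≠ b := by
      rintro rfl
      exact hR a (Finset.mem_insert_self a R) hb
    have hbQ : b ∈ R ∪ qubitsOf m π i := Finset.mem_union_right _ (mem_qubitsOf.2 hb)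
    have haQ : a ∉ R ∪ qubitsOf m π i := by
      rw [Finset.mem_union, mem_qubitsOf, not_or]
      exact ⟨ha, hR a (Finset.mem_insert_self a R)⟩
    -- `c s t` is `φ` with the bits `a`, `b` set to `s`, `t`; it does not depend on these bits.
    let c : Bool → Bool → (Qubit n k m → Bool) → ℝ := fun s t x =>
      φ (Function.update (Function.update x a s) b t)
    have hc : ∀ s t x y, (∀ q ∈ R ∪ qubitsOf m π i, q ≠ b → x q = y q) → c s t x = c s t y := by
      intro s t x y hxy
      refine hφ _ _ fun q hq => ?_
      by_cases hqb : q = b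
      · subst hqb; simp
      by_cases hqa : q = a
      · subst hqa; simp [Function.update_of_ne hqb]
      · rw [Function.update_of_ne hqb, Function.update_of_ne hqb, Function.update_of_ne hqa,
          Function.update_of_ne hqa]
        refine hxy q ?_ hqb
        rw [Finset.insert_union, Finset.mem_insert] at hq
        exact hq.resolve_left hqa
    have hcx : ∀ x, c (x a) (x b) x = φ x := by
      intro x
      simp [c]
    -- `F`, `G`, `H` depend on the bit `a`, on the bit `b`, and on the sum of the two.
    let F : (Qubit n k m → Bool) → ℝ := fun x => if x a then
      (c true false x + c true true x - c false false x - c false true x) / 2 else 0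
    let G : (Qubit n k m → Bool) → ℝ := fun x => c false false x + if x b then
      (c false true x + c true true x - c false false x - c true false x) / 2 else 0
    let H : (Qubit n k m → Bool) → ℝ := fun x => if xor (x a) (x b) then
      (c false true x + c true false x - c false false x - c true true x) / 2 else 0
    have hsum : phase φ = phase G * phase F * phase H := by
      rw [← phase_add, ← phase_add]
      congr 1
      funext x
      rw [← hcx x]
      cases hs : x a <;> cases ht : x b <;> simp [F, G, H, hs, ht] <;> ring
    have hG : Achievable π (2 * 3 ^ R.card - 2) (phase G) := by
      refine ih G fun x y hxy => ?_
      have h := fun s t => hc s t x y fun q hq _ => hxy q hq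
      simp only [G, h, hxy b hbQ]
    have hF : Achievable π (2 * 3 ^ R.card - 2 + 2) (phase F) := by
      refine Achievable.of_submatrix (swapBits_symm a b) (swapBits_supportedOn a b) ?_
      rw [phase, submatrix_diagonal_equiv]
      refine ih (F ∘ swapBits a b) fun x y hxy => ?_
      have h : ∀ s t, c s t (swapBits a b x) = c s t (swapBits a b y) := fun s t => by
        refine hc s t _ _ fun q hq hqb => ?_
        have hqa : q ≠ a := by rintro rfl; exact haQ hq
        rw [swapBits_apply, swapBits_apply, Function.comp_apply, Function.comp_apply,
          Equiv.swap_apply_of_ne_of_ne hqa hqb, hxy q hq]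
      have h' : swapBits a b x a = swapBits a b y a := by
        simp [swapBits_apply, hxy b hbQ]
      simp only [F, Function.comp_apply, h, h']
    have hH : Achievable π (2 * 3 ^ R.card - 2 + 2) (phase H) := by
      refine Achievable.of_submatrix (cnot_symm hab) (cnot_supportedOn hab) ?_
      rw [phase, submatrix_diagonal_equiv]
      refine ih (H ∘ cnot hab) fun x y hxy => ?_
      have h : ∀ s t, c s t (cnot hab x) = c s t (cnot hab y) := fun s t => by
        refine hc s t _ _ fun q hq hqb => ?_
        rw [cnot_apply, cnot_apply, Function.update_of_ne hqb, Function.update_of_ne hqb, hxy q hq]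
      have h' : ∀ z, xor (cnot hab z a) (cnot hab z b) = z b := by
        intro z
        rw [cnot_apply, Function.update_of_ne hab, Function.update_self]
        cases z a <;> cases z b <;> rfl
      simp only [H, Function.comp_apply, h, h', hxy b hbQ]
    rw [hsum]
    refine ((hG.mul hF).mul hH).mono ?_
    have h3 : 1 ≤ 3 ^ R.card := Nat.one_le_pow _ _ (by norm_num)
    rw [Finset.card_insert_of_notMem ha, pow_succ]
    lia

section SelectBit

variable {Q : Type} [DecidableEq Q] (a : Q) (S : Finset Q)

/-- Splitting the bits on `insert a S` into the bit `a`, which selects the summand, and the bits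
on `S`. -/
def selectBit (u : ↥(insert a S) → Bool) : (S → Bool) ⊕ (S → Bool) :=
  if u ⟨a, Finset.mem_insert_self a S⟩ then
    Sum.inr fun q => u ⟨q, Finset.mem_insert_of_mem q.2⟩
  else Sum.inl fun q => u ⟨q, Finset.mem_insert_of_mem q.2⟩

variable {a S}

lemma selectBit_bijective (ha : a ∉ S) : Function.Bijective (selectBit a S) := by
  constructor
  · intro u v huv
    funext ⟨q, hq⟩
    have key : u ⟨a, Finset.mem_insert_self a S⟩ = v ⟨a, Finset.mem_insert_self a S⟩ ∧
        ∀ q : S, u ⟨q, Finset.mem_insert_of_mem q.2⟩ = v ⟨q, Finset.mem_insert_of_mem q.2⟩ := by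
      cases hu : u ⟨a, Finset.mem_insert_self a S⟩ <;>
        cases hv : v ⟨a, Finset.mem_insert_self a S⟩ <;>
        simp [selectBit, hu, hv] at huv ⊢
      all_goals exact fun q hq => congrFun huv ⟨q, hq⟩
    rcases Finset.mem_insert.1 hq with h | h
    · subst h; exact key.1
    · exact key.2 ⟨q, h⟩
  · have hne : ∀ q : S, (q : Q) ≠ a := fun q h => ha (h ▸ q.2)
    rintro (v | v)
    · refine ⟨fun q => if h : (q : Q) ∈ S then v ⟨q, h⟩ else false, ?_⟩
      simp [selectBit, ha]
    · refine ⟨fun q => if h : (q : Q) ∈ S then v ⟨q, h⟩ else true, ?_⟩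
      simp [selectBit, ha]

variable [Fintype Q]

/-- The operator on the qubits `insert a S` given by a `2 × 2` block matrix, where the bit `a`
selects the block. -/
def onBlocks (a : Q) (S : Finset Q)
    (A : Matrix ((S → Bool) ⊕ (S → Bool)) ((S → Bool) ⊕ (S → Bool)) ℂ) :
    Matrix (Q → Bool) (Q → Bool) ℂ :=
  onQubits (insert a S) (A.submatrix (selectBit a S) (selectBit a S))

lemma onBlocks_mul (ha : a ∉ S) (A B : Matrix ((S → Bool) ⊕ (S → Bool)) _ ℂ) :
    onBlocks a S (A * B) = onBlocks a S A * onBlocks a S B := by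
  rw [onBlocks, onBlocks, onBlocks, ← onQubits_mul]
  congr 1
  exact (submatrix_mul_equiv A B _ (Equiv.ofBijective _ (selectBit_bijective ha)) _).symm

lemma onBlocks_mem_unitary (ha : a ∉ S) {A : Matrix ((S → Bool) ⊕ (S → Bool)) _ ℂ}
    (hA : A ∈ unitaryGroup _ ℂ) : onBlocks a S A ∈ unitaryGroup (Q → Bool) ℂ :=
  onQubits_mem_unitary
    ⟨_, submatrix_mem_unitary hA (Equiv.ofBijective _ (selectBit_bijective ha))⟩

lemma onBlocks_diag (ha : a ∉ S) (V : Matrix (S → Bool) (S → Bool) ℂ) :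
    onBlocks a S (fromBlocks V 0 0 V) = onQubits S V := by
  ext x y
  rw [onBlocks, onQubits_apply, onQubits_apply]
  by_cases h : ∀ q, q ∉ S → x q = y q
  · rw [if_pos h, if_pos fun q hq => h q fun hS => hq (Finset.mem_insert_of_mem hS)]
    have := h a ha
    cases hy : y a <;> rw [hy] at this <;> simp [selectBit, this, hy]
  · rw [if_neg h]
    split_ifs with h'
    · have hne : x a ≠ y a := by
        intro hxy
        refine h fun q hq => ?_
        by_cases hqa : q = a
        · rw [hqa, hxy]
        · exact h' q (by simp [hqa, hq])
      cases hx : x a <;> cases hy : y a <;> rw [hx, hy] at hne <;> simp [selectBit, hx, hy] at hne ⊢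
    · rfl

lemma onBlocks_phase (ha : a ∉ S) (φ : (S → Bool) ⊕ (S → Bool) → ℝ) :
    onBlocks a S (phase φ) = phase fun x => φ (selectBit a S fun q => x q) := by
  ext x y
  rw [onBlocks, onQubits_apply, phase, phase]
  by_cases hxy : x = y
  · subst hxy; simp
  · rw [diagonal_apply_ne _ hxy]
    split_ifs with h
    · rw [submatrix_apply, diagonal_apply_ne]
      intro hs
      have := (selectBit_bijective ha).1 hs
      refine hxy (funext fun q => ?_)
      by_cases hq : q ∈ insert a S
      · exact congrFun this ⟨q, hq⟩
      · exact h q hq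
    · rfl

lemma onBlocks_smul_one_supportedOn (ha : a ∉ S) (α β γ δ : ℂ) :
    SupportedOn {a} (onBlocks a S (fromBlocks (α • 1) (β • 1) (γ • 1) (δ • 1))) := by
  have happ : ∀ x y : Q → Bool, (∀ q, q ∉ ({a} : Finset Q) → x q = y q) →
      onBlocks a S (fromBlocks (α • 1) (β • 1) (γ • 1) (δ • 1)) x y =
        if x a then (if y a then δ else γ) else if y a then β else α := by
    intro x y h
    have hS : (fun q : S => x q) = fun q : S => y q :=
      funext fun q => h q (by simpa using fun hq : (q : Q) = a => ha (hq ▸ q.2))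
    rw [onBlocks, onQubits_apply, if_pos]
    · cases hx : x a <;> cases hy : y a <;> simp [selectBit, hx, hy, hS]
    · exact fun q hq => h q fun hq' => hq (by simp_all)
  refine supportedOn_of_apply ?_ ?_
  · rintro x y ⟨q, hq, hne⟩
    rw [Finset.mem_singleton] at hq
    rw [onBlocks, onQubits_apply]
    split_ifs with h
    · have hqS : q ∈ S := by
        by_contra hqS
        exact hne (h q (by simp [hq, hqS]))
      have hS : (fun q : S => x q) ≠ fun q : S => y q := fun h => hne (congrFun h ⟨q, hqS⟩)
      cases hx : x a <;> cases hy : y a <;> simp [selectBit, hx, hy, hS]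
    · rfl
  · intro x y x' y' hxy hxy' hx hy
    rw [happ x y hxy, happ x' y' hxy', hx a (by simp), hy a (by simp)]

end SelectBit

/-- Every unitary on one processor and a set `R` of further qubits needs only `O(4 ^ |R|)` nonlocal
gates: the cosine-sine decomposition removes one qubit of `R` at the price of four unitaries and
three diagonal ones. -/
lemma achievable_unitary (i : Fin k) (R : Finset (Qubit n k m)) (hR : ∀ q ∈ R, proc π q ≠ i)
    (hb : R.Nonempty → ∃ b : Qubit n k m, proc π b = i) :
    ∀ M : Matrix (Qubit n k m → Bool) (Qubit n k m → Bool) ℂ, M ∈ unitaryGroup _ ℂ →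
      SupportedOn (R ∪ qubitsOf m π i) M →
      Achievable π (18 * 4 ^ R.card - 18 * 3 ^ R.card) M := by
  induction R using Finset.induction_on with
  | empty =>
    intro M hM hs
    exact achievable_local (i := i) (by simpa using hs) hM
  | insert a R ha ih =>
    intro M hM hs
    obtain ⟨b, hb⟩ := hb (Finset.insert_nonempty a R)
    have ih := ih (fun q hq => hR q (Finset.mem_insert_of_mem hq)) fun _ => ⟨b, hb⟩
    have hphase := achievable_phase i b hb (insert a R) hR
    have haS : a ∉ R ∪ qubitsOf m π i := by
      rw [Finset.mem_union, mem_qubitsOf, not_or]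
      exact ⟨ha, hR a (Finset.mem_insert_self a R)⟩
    rw [Finset.insert_union] at hs hphase
    set S := R ∪ qubitsOf m π i
    obtain ⟨V, rfl⟩ := hs.exists_unitary hM
    let e := Equiv.ofBijective _ (selectBit_bijective haS)
    obtain ⟨V₁, hV₁, W₁, hW₁, V₂, hV₂, W₂, hW₂, φ₁, φ₂, φ₃, h⟩ :=
      exists_shannon (V.1.submatrix e.symm e.symm) (submatrix_mem_unitary V.2 e.symm)
    have hV : onQubits (insert a S) V.1 = onBlocks a S (V.1.submatrix e.symm e.symm) := by
      rw [onBlocks]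
      congr 1
      change _ = (V.1.submatrix e.symm e.symm).submatrix e e
      simp
    have hmul : ∀ W ∈ unitaryGroup (S → Bool) ℂ,
        Achievable π (18 * 4 ^ R.card - 18 * 3 ^ R.card) (onBlocks a S (fromBlocks W 0 0 W)) := by
      intro W hW
      rw [onBlocks_diag haS]
      exact ih _ (onQubits_mem_unitary ⟨W, hW⟩) (supportedOn_onQubits S W)
    have hdiag : ∀ φ, Achievable π (2 * 3 ^ (insert a R).card - 2) (onBlocks a S (phase φ)) := by
      intro φ
      rw [onBlocks_phase haS]
      refine hphase _ fun x y hxy => ?_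
      congr 2
      funext q
      exact hxy q q.2
    have hsub : ({a} : Finset (Qubit n k m)) ⊆ qubitsOf m π (proc π a) := by
      intro q hq
      rw [Finset.mem_singleton.1 hq]
      exact mem_qubitsOf.2 rfl
    have hK : Achievable π 0 (onBlocks a S (rotationFrame _)) :=
      achievable_local ((onBlocks_smul_one_supportedOn haS _ _ _ _).mono hsub)
        (onBlocks_mem_unitary haS rotationFrame_mem)
    have hK' : Achievable π 0 (onBlocks a S (rotationFrame _)ᴴ) := by
      refine achievable_local (SupportedOn.mono hsub ?_)
        (onBlocks_mem_unitary haS (Unitary.star_mem rotationFrame_mem))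
      rw [rotationFrame, fromBlocks_conjTranspose]
      simp only [conjTranspose_smul, conjTranspose_one]
      exact onBlocks_smul_one_supportedOn haS _ _ _ _
    rw [hV, h]
    simp only [onBlocks_mul haS]
    refine (((((hmul V₁ hV₁).mul (hdiag φ₁)).mul (hmul W₁ hW₁)).mul
      ((hK.mul (hdiag φ₂)).mul hK')).mul (((hmul V₂ hV₂).mul (hdiag φ₃)).mul (hmul W₂ hW₂))).mono ?_
    rw [Finset.card_insert_of_notMem ha, pow_succ, pow_succ]
    have h3 : 1 ≤ 3 ^ R.card := Nat.one_le_pow _ _ (by norm_num)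
    have h4 : 3 ^ R.card ≤ 4 ^ R.card := Nat.pow_le_pow_left (by norm_num) _
    lia

lemma SupportedOn.submatrix_swapBits {Q : Type} [Fintype Q] [DecidableEq Q] {D D' : Finset Q}
    {M : Matrix (Q → Bool) (Q → Bool) ℂ} (h : SupportedOn D M) (a c : Q)
    (hD : ∀ q, q ∈ D' ↔ Equiv.swap a c q ∈ D) :
    SupportedOn D' (M.submatrix (swapBits a c) (swapBits a c)) := by
  have hD' : ∀ q, q ∈ D ↔ Equiv.swap a c q ∈ D' := fun q => by simp [hD]
  refine supportedOn_of_apply ?_ ?_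
  · rintro x y ⟨q, hq, hne⟩
    refine h.apply_eq_zero (q := Equiv.swap a c q) (by rwa [← hD]) ?_
    simpa [swapBits_apply] using hne
  · intro x y x' y' hxy hxy' hx hy
    exact h.apply_congr (fun q hq => hxy _ (by rwa [← hD'])) (fun q hq => hxy' _ (by rwa [← hD']))
      (fun q hq => hx _ (by rwa [← hD'])) fun q hq => hy _ (by rwa [← hD'])

/-- Swapping `|A|` qubits of `D` into unused qubits `A` of processor `i` shrinks the part of `D`
outside that processor. -/
lemma achievable_of_free_qubits (i : Fin k) (A : Finset (Qubit n k m)) :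
    ∀ D : Finset (Qubit n k m), A ⊆ qubitsOf m π i → Disjoint A D →
      A.card ≤ (D \ qubitsOf m π i).card →
      ((D \ qubitsOf m π i).Nonempty → ∃ b : Qubit n k m, proc π b = i) →
      ∀ M : Matrix (Qubit n k m → Bool) (Qubit n k m → Bool) ℂ, M ∈ unitaryGroup _ ℂ →
        SupportedOn D M →
        Achievable π (2 * A.card + (18 * 4 ^ ((D \ qubitsOf m π i).card - A.card) -
          18 * 3 ^ ((D \ qubitsOf m π i).card - A.card))) M := by
  induction A using Finset.induction_on with
  | empty =>
    intro D _ _ _ hb M hM hs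
    refine (achievable_unitary i (D \ qubitsOf m π i) ?_ hb M hM (hs.mono ?_)).mono ?_
    · intro q hq
      rw [Finset.mem_sdiff, mem_qubitsOf] at hq
      exact hq.2
    · rw [Finset.sdiff_union_self_eq_union]
      exact Finset.subset_union_left
    · simp
  | insert c A hc ih =>
    intro D hA hAD hcard hb M hM hs
    rw [Finset.card_insert_of_notMem hc] at hcard ⊢
    obtain ⟨a, ha⟩ : (D \ qubitsOf m π i).Nonempty := by
      rw [← Finset.card_pos]; lia
    have haD := (Finset.mem_sdiff.1 ha).1
    have haQ := (Finset.mem_sdiff.1 ha).2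
    have hcQ : c ∈ qubitsOf m π i := hA (Finset.mem_insert_self c A)
    have hcD : c ∉ D := Finset.disjoint_left.1 hAD (Finset.mem_insert_self c A)
    have hac : a ≠ c := by rintro rfl; exact hcD haD
    let D' := insert c (D.erase a)
    have hD' : D' \ qubitsOf m π i = (D \ qubitsOf m π i).erase a := by
      ext q
      simp only [D', Finset.mem_sdiff, Finset.mem_insert, Finset.mem_erase]
      constructor
      · rintro ⟨rfl | h, h'⟩
        · exact absurd hcQ h'
        · exact ⟨h.1, h.2, h'⟩
      · rintro ⟨h, h', h''⟩
        exact ⟨Or.inr ⟨h, h'⟩, h''⟩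
    have hcard' : (D' \ qubitsOf m π i).card = (D \ qubitsOf m π i).card - 1 := by
      rw [hD', Finset.card_erase_of_mem ha]
    have h := ih D' (fun q hq => hA (Finset.mem_insert_of_mem hq)) ?_ (by lia)
      (fun _ => ⟨c, mem_qubitsOf.1 hcQ⟩) (M.submatrix (swapBits a c) (swapBits a c))
      (submatrix_mem_unitary hM _) (hs.submatrix_swapBits a c ?_)
    · refine (Achievable.of_submatrix (swapBits_symm a c) (swapBits_supportedOn a c) h).mono ?_
      rw [hcard', Nat.sub_sub, add_comm 1]
      lia
    · rw [Finset.disjoint_left] at hAD ⊢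
      intro q hq hqD
      rcases Finset.mem_insert.1 hqD with rfl | hq'
      · exact hc hq
      · exact hAD (Finset.mem_insert_of_mem hq) (Finset.mem_of_mem_erase hq')
    · intro q
      simp only [D', Finset.mem_insert, Finset.mem_erase]
      by_cases hqa : q = a
      · subst hqa; simp [hac, hcD]
      by_cases hqc : q = c
      · subst hqc; simp [haD]
      · rw [Equiv.swap_apply_of_ne_of_ne hqa hqc]
        simp [hqa, hqc]

end Synthesis

/-! ### The upper bound -/

section UpperBound

variable {n k m : ℕ}

/-- The data qubits. -/
def dataQubits (n k m : ℕ) : Finset (Qubit n k m) :=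
  Finset.univ.map Function.Embedding.inl

lemma mem_dataQubits {q : Qubit n k m} : q ∈ dataQubits n k m ↔ ∃ j, q = Sum.inl j := by
  simp [dataQubits, eq_comm]

/-- The operator that applies `U` to the data qubits. -/
def onData (k m : ℕ) (U : Matrix (Fin n → Bool) (Fin n → Bool) ℂ) :
    Matrix (Qubit n k m → Bool) (Qubit n k m → Bool) ℂ :=
  onQubits (dataQubits n k m) (U.submatrix (fun u j => u ⟨Sum.inl j, mem_dataQubits.2 ⟨j, rfl⟩⟩)
    fun u j => u ⟨Sum.inl j, mem_dataQubits.2 ⟨j, rfl⟩⟩)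

lemma onData_mem_unitary (U : QubitUnitary (Fin n)) :
    onData k m U.1 ∈ unitaryGroup (Qubit n k m → Bool) ℂ := by
  have hb : Function.Bijective fun (u : dataQubits n k m → Bool) (j : Fin n) =>
      u ⟨Sum.inl j, mem_dataQubits.2 ⟨j, rfl⟩⟩ := by
    constructor
    · intro u v huv
      funext ⟨q, hq⟩
      obtain ⟨j, rfl⟩ := mem_dataQubits.1 hq
      exact congrFun huv j
    · intro x
      refine ⟨fun q => Sum.elim x (fun _ => false) q.1, ?_⟩
      simp
  exact onQubits_mem_unitary ⟨_, submatrix_mem_unitary U.2 (Equiv.ofBijective _ hb)⟩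

lemma onData_mulVec (U : Matrix (Fin n → Bool) (Fin n → Bool) ℂ) (ψ : (Fin n → Bool) → ℂ) :
    (onData k m U).mulVec (withAncillas k m ψ) = withAncillas k m (U.mulVec ψ) := by
  have hoff : ∀ q : Qubit n k m, q ∉ dataQubits n k m ↔ ∃ a, q = Sum.inr a := by
    rintro (j | a) <;> simp [mem_dataQubits]
  funext z
  rw [Matrix.mulVec, dotProduct, withAncillas]
  split_ifs with hz
  · symm
    rw [Matrix.mulVec, dotProduct]
    refine Finset.sum_of_injOn (fun x : Fin n → Bool => (Sum.elim x fun _ => false : _ → Bool))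
      ?_ (by simp) ?_ ?_
    · intro x _ y _ hxy
      funext j
      exact congrFun hxy (Sum.inl j)
    · intro y _ hy
      rw [withAncillas, if_neg, mul_zero]
      intro h
      refine hy ⟨fun j => y (Sum.inl j), by simp, ?_⟩
      funext q
      rcases q with j | a
      · rfl
      · exact (h a).symm
    · intro x _
      rw [onData, onQubits_apply, if_pos, withAncillas, if_pos]
      · rfl
      · simp
      · intro q hq
        obtain ⟨a, rfl⟩ := (hoff q).1 hq
        rw [hz a, Sum.elim_inr]
  · refine Finset.sum_eq_zero fun y _ => ?_
    rw [withAncillas]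
    split_ifs with hy
    · rw [onData, onQubits_apply, if_neg, zero_mul]
      intro h
      refine hz fun a => ?_
      rw [h _ ((hoff _).2 ⟨a, rfl⟩), hy a]
    · simp

lemma commComplexity_le {b : ℝ} {π : Fin n → Fin k} (hπ : Balanced b π) {U : QubitUnitary (Fin n)}
    {r : ℕ} (h : Achievable π r (onData k m U.1)) : commComplexity b k m U ≤ r := by
  obtain ⟨T, hT, hr⟩ := h
  refine (iInf₂_le π hπ).trans ((iInf₂_le T ?_).trans (by exact_mod_cast hr))
  intro ψ
  rw [hT, onData_mulVec]

/-- The distribution of the data qubits that deals them out in turn. -/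
def dealOut (n : ℕ) {k : ℕ} (hk : 0 < k) (j : Fin n) : Fin k := ⟨j % k, Nat.mod_lt _ hk⟩

lemma card_dealOut (hk : 0 < k) (i : Fin k) :
    (Finset.univ.filter fun j => dealOut n hk j = i).card =
      n / k + if (i : ℕ) < n % k then 1 else 0 := by
  have h := Nat.count_modEq_card n hk i
  rw [Nat.mod_eq_of_lt i.2] at h
  rw [← h, Nat.count_eq_card_filter_range, ← Finset.card_map Fin.valEmbedding]
  congr 1
  ext j
  simp only [Finset.mem_map, Finset.mem_filter, Finset.mem_univ, true_and, Finset.mem_range,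
    Fin.valEmbedding_apply, Nat.ModEq, dealOut, Fin.ext_iff, Nat.mod_eq_of_lt i.2]
  constructor
  · rintro ⟨j, hj, rfl⟩
    exact ⟨j.2, hj⟩
  · rintro ⟨hj, h⟩
    exact ⟨⟨j, hj⟩, h, rfl⟩

lemma balanced_dealOut {b : ℝ} (hb : 1 ≤ b) (hk : 0 < k) : Balanced b (dealOut n hk) := by
  intro i
  refine lt_of_lt_of_le ?_ hb
  have hk' : (0 : ℝ) < k := by exact_mod_cast hk
  have hmod : (n : ℝ) = k * (n / k : ℕ) + (n % k : ℕ) := by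
    exact_mod_cast (Nat.div_add_mod n k).symm
  have hlt : ((n % k : ℕ) : ℝ) < k := by exact_mod_cast Nat.mod_lt n hk
  have hdiv : (n : ℝ) / k = (n / k : ℕ) + (n % k : ℕ) / k := by
    field_simp
    exact hmod
  have h1 : ((n % k : ℕ) : ℝ) / k < 1 := (div_lt_one hk').2 hlt
  have h0 : 0 ≤ ((n % k : ℕ) : ℝ) / k := by positivity
  rw [card_dealOut, hdiv, abs_lt]
  split_ifs with h
  · have : 0 < ((n % k : ℕ) : ℝ) / k := by
      have : 0 < n % k := by lia
      positivity
    push_cast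
    constructor <;> linarith
  · push_cast
    constructor <;> linarith

/-- Processor `0` holds the largest share of the data qubits. -/
lemma le_card_dealOut_zero (hk : 0 < k) :
    (n : ℝ) / k ≤ ((Finset.univ.filter fun j => dealOut n hk j = ⟨0, hk⟩).card : ℝ) := by
  have hk' : (0 : ℝ) < k := by exact_mod_cast hk
  rw [card_dealOut, div_le_iff₀ hk']
  have hmod := Nat.div_add_mod n k
  have hlt := Nat.mod_lt n hk
  have : n ≤ (n / k + if 0 < n % k then 1 else 0) * k := by
    split_ifs with h
    · nlinarith
    · rw [add_zero, mul_comm]; lia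
  exact_mod_cast this

theorem upperBound {b : ℝ} (hb : 1 ≤ b) (n k m : ℕ) (hk : 2 ≤ k) (U : QubitUnitary (Fin n)) :
    ((commComplexity b k m U : ℕ∞) : ENNReal) ≤ ENNReal.ofReal (20 * commBound n k m) := by
  have hk0 : 0 < k := by lia
  set π : Fin n → Fin k := dealOut n hk0
  set i : Fin k := ⟨0, hk0⟩
  set n₀ := (Finset.univ.filter fun j => π j = i).card with hn₀
  have hn₀n : n₀ ≤ n := by
    simpa using Finset.card_filter_le (Finset.univ : Finset (Fin n)) (π · = i)
  have hle : (n : ℝ) / k ≤ n₀ := le_card_dealOut_zero hk0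
  set D := dataQubits n k m
  have hD : (D \ qubitsOf m π i).card = n - n₀ := by
    have : D \ qubitsOf m π i =
        (Finset.univ.filter fun j => ¬ π j = i).map Function.Embedding.inl := by
      ext q
      rcases q with j | a <;> simp [D, mem_dataQubits, mem_qubitsOf, proc]
    rw [this, Finset.card_map, hn₀]
    have := Finset.card_filter_add_card_filter_not (s := (Finset.univ : Finset (Fin n))) (π · = i)
    simp only [Finset.card_univ, Fintype.card_fin] at this
    lia
  obtain ⟨A, hA, hAcard⟩ : ∃ A ⊆ (Finset.univ.map
      ⟨fun l : Fin m => (Sum.inr (i, l) : Qubit n k m),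
        fun a b h => (Prod.ext_iff.1 (Sum.inr_injective h)).2⟩),
      A.card = min m (n - n₀) :=
    Finset.exists_subset_card_eq (by simp)
  have hA' : ∀ q ∈ A, ∃ l, q = Sum.inr (i, l) := by
    intro q hq
    obtain ⟨l, -, rfl⟩ := Finset.mem_map.1 (hA hq)
    exact ⟨l, rfl⟩
  have hach := achievable_of_free_qubits (π := π) i A D ?_ ?_ (by rw [hD, hAcard]; lia) ?_
    (onData k m U.1) (onData_mem_unitary U) (supportedOn_onQubits _ _)
  rotate_left
  · intro q hq
    obtain ⟨l, rfl⟩ := hA' q hq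
    exact mem_qubitsOf.2 rfl
  · rw [Finset.disjoint_left]
    intro q hq
    obtain ⟨l, rfl⟩ := hA' q hq
    simp [D, mem_dataQubits]
  · intro hne
    have hpos : 0 < n₀ := by
      have h1 : 0 < n := by
        have := Finset.card_pos.2 hne
        lia
      have : (0 : ℝ) < n₀ := lt_of_lt_of_le (by positivity) hle
      exact_mod_cast this
    obtain ⟨j, hj⟩ := Finset.card_pos.1 hpos
    exact ⟨Sum.inl j, by simpa [proc] using hj⟩
  rw [hD, hAcard] at hach
  set t := n - n₀ - min m (n - n₀) with ht
  have hr : ((2 * min m (n - n₀) + (18 * 4 ^ t - 18 * 3 ^ t) : ℕ) : ℝ) ≤ 20 * commBound n k m := by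
    have hn : (n : ℝ) ≤ commBound n k m := le_max_right _ _
    have hX : (4 : ℝ) ^ ((1 - 1 / (k : ℝ)) * (n : ℝ) - (m : ℝ)) ≤ commBound n k m := le_max_left _ _
    have hX0 : (0 : ℝ) < (4 : ℝ) ^ ((1 - 1 / (k : ℝ)) * (n : ℝ) - (m : ℝ)) := by positivity
    have hn' : (0 : ℝ) ≤ n := by positivity
    have hmin : ((min m (n - n₀) : ℕ) : ℝ) ≤ n := by
      exact_mod_cast (min_le_right _ _).trans (Nat.sub_le n n₀)
    rcases le_or_gt (n - n₀) m with hm | hm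
    · -- All data qubits fit into processor `0`: only the swaps are nonlocal.
      have ht0 : t = 0 := by lia
      rw [ht0]
      push_cast at hmin ⊢
      norm_num
      linarith
    · have ht' : t = n - n₀ - m := by lia
      have hpow : (4 : ℝ) ^ t ≤ (4 : ℝ) ^ ((1 - 1 / (k : ℝ)) * (n : ℝ) - (m : ℝ)) := by
        rw [← Real.rpow_natCast]
        refine Real.rpow_le_rpow_of_exponent_le (by norm_num) ?_
        rw [ht', Nat.cast_sub (by lia), Nat.cast_sub hn₀n]
        have : (1 - 1 / (k : ℝ)) * n = n - n / k := by ring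
        linarith
      calc ((2 * min m (n - n₀) + (18 * 4 ^ t - 18 * 3 ^ t) : ℕ) : ℝ)
          ≤ ((2 * min m (n - n₀) + 18 * 4 ^ t : ℕ) : ℝ) := by
            exact_mod_cast Nat.add_le_add_left (Nat.sub_le _ _) _
        _ ≤ 20 * commBound n k m := by
          push_cast at hmin ⊢
          linarith
  have h1 := commComplexity_le (balanced_dealOut hb hk0) hach
  calc ((commComplexity b k m U : ℕ∞) : ENNReal) ≤
        (((2 * min m (n - n₀) + (18 * 4 ^ t - 18 * 3 ^ t) : ℕ) : ℕ∞) : ENNReal) := by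
          exact_mod_cast h1
    _ = ENNReal.ofReal (2 * min m (n - n₀) + (18 * 4 ^ t - 18 * 3 ^ t) : ℕ) := by
          rw [ENNReal.ofReal_natCast, ENat.toENNReal_coe]
    _ ≤ _ := ENNReal.ofReal_le_ofReal hr

end UpperBound

/-! ### Counting parameters -/

section Dimension

/-- The set `A` of matrices is covered by a `C¹` image of `ℝ ^ d`. Smoothness is asked of each
entry, so that no norm on matrices is needed. -/
def CoveredBy {ι κ : Type} (d : ℕ) (A : Set (Matrix ι κ ℂ)) : Prop :=
  ∃ f : (Fin d → ℝ) → Matrix ι κ ℂ, (∀ i j, ContDiff ℝ 1 fun p => f p i j) ∧ A ⊆ Set.range f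

variable {ι κ : Type} {d e : ℕ}

lemma CoveredBy.mono {A B : Set (Matrix ι κ ℂ)} (h : CoveredBy d A) (hBA : B ⊆ A) (hde : d ≤ e) :
    CoveredBy e B := by
  obtain ⟨f, hf, hA⟩ := h
  refine ⟨fun p => f fun i => p (Fin.castLE hde i), fun i j => ?_, ?_⟩
  · exact (hf i j).comp (contDiff_pi.2 fun l => contDiff_apply ℝ ℝ _)
  · intro M hM
    obtain ⟨p, rfl⟩ := hA (hBA hM)
    refine ⟨fun i => if h : (i : ℕ) < d then p ⟨i, h⟩ else 0, ?_⟩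
    funext i
    simp

lemma CoveredBy.image {ι' κ' : Type} {A : Set (Matrix ι κ ℂ)} (h : CoveredBy d A)
    (Φ : Matrix ι κ ℂ → Matrix ι' κ' ℂ)
    (hΦ : ∀ f : (Fin d → ℝ) → Matrix ι κ ℂ, (∀ i j, ContDiff ℝ 1 fun p => f p i j) →
      ∀ i j, ContDiff ℝ 1 fun p => Φ (f p) i j) : CoveredBy d (Φ '' A) := by
  obtain ⟨f, hf, hA⟩ := h
  refine ⟨fun p => Φ (f p), hΦ f hf, ?_⟩
  rintro _ ⟨M, hM, rfl⟩
  obtain ⟨p, rfl⟩ := hA hM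
  exact ⟨p, rfl⟩

lemma CoveredBy.image2 {ι₁ ι₂ ι₃ κ₁ κ₂ κ₃ : Type} {A : Set (Matrix ι₁ κ₁ ℂ)}
    {B : Set (Matrix ι₂ κ₂ ℂ)} (hA : CoveredBy d A) (hB : CoveredBy e B)
    (Φ : Matrix ι₁ κ₁ ℂ → Matrix ι₂ κ₂ ℂ → Matrix ι₃ κ₃ ℂ)
    (hΦ : ∀ (f : (Fin (d + e) → ℝ) → Matrix ι₁ κ₁ ℂ) (g : (Fin (d + e) → ℝ) → Matrix ι₂ κ₂ ℂ),
      (∀ i j, ContDiff ℝ 1 fun p => f p i j) → (∀ i j, ContDiff ℝ 1 fun p => g p i j) →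
      ∀ i j, ContDiff ℝ 1 fun p => Φ (f p) (g p) i j) :
    CoveredBy (d + e) (Set.image2 Φ A B) := by
  obtain ⟨f, hf, hA⟩ := hA
  obtain ⟨g, hg, hB⟩ := hB
  refine ⟨fun p => Φ (f fun i => p (Fin.castAdd e i)) (g fun i => p (Fin.natAdd d i)),
    hΦ _ _ (fun i j => ?_) (fun i j => ?_), ?_⟩
  · exact (hf i j).comp (contDiff_pi.2 fun l => contDiff_apply ℝ ℝ _)
  · exact (hg i j).comp (contDiff_pi.2 fun l => contDiff_apply ℝ ℝ _)
  · rintro _ ⟨M, hM, N, hN, rfl⟩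
    obtain ⟨p, rfl⟩ := hA hM
    obtain ⟨q, rfl⟩ := hB hN
    exact ⟨Fin.append p q, by simp⟩

lemma CoveredBy.mul [Fintype ι] {A B : Set (Matrix ι ι ℂ)} (hA : CoveredBy d A)
    (hB : CoveredBy e B) : CoveredBy (d + e) (Set.image2 (· * ·) A B) := by
  refine hA.image2 hB _ fun f g hf hg i j => ?_
  simp only [Matrix.mul_apply]
  exact ContDiff.sum fun l _ => (hf i l).mul (hg l j)

lemma CoveredBy.add {A B : Set (Matrix ι κ ℂ)} (hA : CoveredBy d A)
    (hB : CoveredBy e B) : CoveredBy (d + e) (Set.image2 (· + ·) A B) := by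
  refine hA.image2 hB _ fun f g hf hg i j => ?_
  simp only [Matrix.add_apply]
  exact (hf i j).add (hg i j)

lemma coveredBy_singleton (M : Matrix ι κ ℂ) : CoveredBy 0 {M} :=
  ⟨fun _ => M, fun _ _ => contDiff_const, fun _ hN => ⟨0, hN.symm⟩⟩

lemma coveredBy_univ [Fintype ι] [Fintype κ] :
    CoveredBy (2 * (Fintype.card ι * Fintype.card κ)) (Set.univ : Set (Matrix ι κ ℂ)) := by
  have e : (Bool × ι × κ) ≃ Fin (2 * (Fintype.card ι * Fintype.card κ)) :=
    Fintype.equivFinOfCardEq (by simp)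
  refine ⟨fun p => Matrix.of fun i j =>
    (p (e (false, i, j)) : ℂ) + (p (e (true, i, j)) : ℂ) * Complex.I, fun i j => ?_, ?_⟩
  · simp only [Matrix.of_apply]
    exact (Complex.ofRealCLM.contDiff.comp (contDiff_apply ℝ ℝ _)).add
      ((Complex.ofRealCLM.contDiff.comp (contDiff_apply ℝ ℝ _)).mul contDiff_const)
  · intro M _
    refine ⟨fun l => if (e.symm l).1 then (M (e.symm l).2.1 (e.symm l).2.2).im
      else (M (e.symm l).2.1 (e.symm l).2.2).re, ?_⟩
    ext i j
    simp

lemma coveredBy_supportedOn {Q : Type} [Fintype Q] [DecidableEq Q] (S : Finset Q) :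
    CoveredBy (2 * 4 ^ S.card) {M : Matrix (Q → Bool) (Q → Bool) ℂ | SupportedOn S M} := by
  refine (((coveredBy_univ (ι := S → Bool) (κ := S → Bool)).image (onQubits S) ?_).mono
    (e := 2 * 4 ^ S.card) ?_ ?_)
  · intro f hf x y
    simp only [onQubits_apply]
    split_ifs
    · exact hf _ _
    · exact contDiff_const
  · rintro M ⟨V, rfl⟩
    exact ⟨V, trivial, rfl⟩
  · simp [← mul_pow]

variable {N : Type} [Fintype N] [DecidableEq N]

/-- The real coordinates of the Hermitian part of `U / i`, up to scaling: for `U = S + i H` with `S`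
and `H` Hermitian, this is `2 (Re H + Im H)`, which determines `H`. -/
def hermitianCoords (U : Matrix N N ℂ) (i j : N) : ℝ :=
  (U i j).im + (U j i).im - (U i j).re + (U j i).re

/-- Up to scaling, the anti-Hermitian part of a unitary is arbitrary: a Hermitian matrix with
eigenvalues `sin α` is the imaginary part of the unitary with eigenvalues `exp (i α)`. -/
lemma exists_unitary_hermitianCoords (a : N → N → ℝ) :
    ∃ U ∈ unitaryGroup N ℂ, ∃ t : ℝ, ∀ i j, a i j = t * hermitianCoords U i j := by
  let H : Matrix N N ℂ := Matrix.of fun i j =>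
    (((a i j + a j i) / 2 : ℝ) : ℂ) + (((a i j - a j i) / 2 : ℝ) : ℂ) * Complex.I
  have r1 : ∀ i j, (H i j).re = (a i j + a j i) / 2 := fun i j => by simp [H]
  have r2 : ∀ i j, (H i j).im = (a i j - a j i) / 2 := fun i j => by simp [H]
  have hH : H.IsHermitian := by
    ext i j
    rw [conjTranspose_apply, Complex.star_def]
    apply Complex.ext
    · rw [Complex.conj_re, r1, r1, add_comm]
    · rw [Complex.conj_im, r2, r2]; ring
  let V : Matrix N N ℂ := hH.eigenvectorUnitary.1
  have hVm : V ∈ unitaryGroup N ℂ := hH.eigenvectorUnitary.2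
  let x := hH.eigenvalues
  have hspec : H = V * diagonal (fun l => (x l : ℂ)) * Vᴴ := by
    have h1 := hH.spectral_theorem
    rw [Unitary.conjStarAlgAut_apply] at h1
    exact h1
  let t : ℝ := 1 + ∑ l, |x l|
  have ht : 0 < t := by positivity
  have hxt : ∀ l, |x l / t| ≤ 1 := by
    intro l
    rw [abs_div, abs_of_pos ht, div_le_one ht]
    have := Finset.single_le_sum (fun l _ => abs_nonneg (x l)) (Finset.mem_univ l)
    linarith
  let α : N → ℝ := fun l => Real.arcsin (x l / t)
  have hsin : ∀ l, Real.sin (α l) = x l / t := fun l =>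
    Real.sin_arcsin (abs_le.1 (hxt l)).1 (abs_le.1 (hxt l)).2
  let S := V * diagonal (fun l => (Real.cos (α l) : ℂ)) * Vᴴ
  have hS : Sᴴ = S := by
    rw [conjTranspose_mul, conjTranspose_mul, conjTranspose_conjTranspose, diagonal_conjTranspose,
      ← mul_assoc]
    congr 3
    funext l
    exact Complex.conj_ofReal _
  have hU : V * phase α * Vᴴ = S + (Complex.I / t) • H := by
    have : phase α = diagonal (fun l => (Real.cos (α l) : ℂ)) +
        (Complex.I / t) • diagonal (fun l => (x l : ℂ)) := by
      rw [phase, ← diagonal_smul, diagonal_add]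
      congr 1
      funext l
      rw [Complex.exp_mul_I, ← Complex.ofReal_cos, ← Complex.ofReal_sin, hsin, Pi.smul_apply,
        smul_eq_mul]
      push_cast
      ring
    rw [this, hspec, mul_add, add_mul, mul_smul_comm, smul_mul_assoc]
  refine ⟨V * phase α * Vᴴ, mul_mem (mul_mem hVm (phase_mem_unitary α)) (Unitary.star_mem hVm),
    t / 2, fun i j => ?_⟩
  have hSij : (starRingEnd ℂ) (S j i) = S i j := by
    conv_rhs => rw [← hS]
    rfl
  have hre := congrArg Complex.re hSij
  have him := congrArg Complex.im hSij
  rw [Complex.conj_re] at hre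
  rw [Complex.conj_im] at him
  have hI : Complex.I / (t : ℂ) = ((1 / t : ℝ) : ℂ) * Complex.I := by
    push_cast; ring
  have e1 : ∀ z : ℂ, (Complex.I / (t : ℂ) * z).re = - z.im / t := fun z => by
    rw [hI, mul_assoc, Complex.re_ofReal_mul]; simp; ring
  have e2 : ∀ z : ℂ, (Complex.I / (t : ℂ) * z).im = z.re / t := fun z => by
    rw [hI, mul_assoc, Complex.im_ofReal_mul]; simp; ring
  rw [hU, hermitianCoords]
  simp only [Matrix.add_apply, Matrix.smul_apply, smul_eq_mul, Complex.add_re, Complex.add_im, e1,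
    e2, r1, r2]
  rw [← hre, ← him]
  field_simp
  ring

/-- Countably many families with fewer than `|N| ^ 2` parameters (one less, for the scaling) do not
exhaust the unitary matrices. -/
lemma exists_unitary_notMem {J : Type} [Countable J] (A : J → Set (Matrix N N ℂ))
    (hA : ∀ j, CoveredBy d (A j)) (hd : d + 1 < Fintype.card N * Fintype.card N) :
    ∃ U : unitaryGroup N ℂ, ∀ j, U.1 ∉ A j := by
  by_contra! hcon
  choose f hf hAf using hA
  let g : J → ((Fin d → ℝ) × ℝ) → (N → N → ℝ) := fun j p i l =>
    p.2 * hermitianCoords (f j p.1) i l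
  have hg : ∀ j, ContDiff ℝ 1 (g j) := by
    intro j
    have hre : ∀ i l, ContDiff ℝ 1 fun p : (Fin d → ℝ) × ℝ => (f j p.1 i l).re := fun i l =>
      Complex.reCLM.contDiff.comp ((hf j i l).comp contDiff_fst)
    have him : ∀ i l, ContDiff ℝ 1 fun p : (Fin d → ℝ) × ℝ => (f j p.1 i l).im := fun i l =>
      Complex.imCLM.contDiff.comp ((hf j i l).comp contDiff_fst)
    refine contDiff_pi.2 fun i => contDiff_pi.2 fun l => ?_
    exact contDiff_snd.mul ((((him i l).add (him l i)).sub (hre i l)).add (hre l i))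
  have hcover : (Set.univ : Set (N → N → ℝ)) = ⋃ j, Set.range (g j) := by
    refine (Set.eq_univ_of_forall fun a => ?_).symm
    obtain ⟨U, hU, t, ht⟩ := exists_unitary_hermitianCoords a
    obtain ⟨j, hj⟩ := hcon ⟨U, hU⟩
    obtain ⟨p, hp⟩ := hAf j hj
    have hp : f j p = U := hp
    refine Set.mem_iUnion.2 ⟨j, (p, t), ?_⟩
    funext i l
    simp only [g, hp, ht]
  have h1 : dimH (Set.univ : Set (N → N → ℝ)) ≤ ((d + 1 : ℕ) : ENNReal) := by
    rw [hcover, dimH_iUnion]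
    refine iSup_le fun j => ?_
    refine (hg j).dimH_range_le.trans ?_
    simp
  rw [Real.dimH_univ_eq_finrank] at h1
  have h2 : Module.finrank ℝ (N → N → ℝ) = Fintype.card N * Fintype.card N := by
    rw [Module.finrank_pi_fintype]
    simp
  rw [h2] at h1
  have : Fintype.card N * Fintype.card N ≤ d + 1 := by exact_mod_cast h1
  lia

end Dimension

/-! ### Products of operators on prescribed qubits -/

section Words

variable {Q : Type}

/-- The number of complex parameters of a product of operators supported on the sets of a list. -/
def weight (w : List (Finset Q)) : ℕ := (w.map fun S => 4 ^ S.card).sum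

lemma weight_append (w w' : List (Finset Q)) : weight (w ++ w') = weight w + weight w' := by
  simp [weight]

variable [Fintype Q] [DecidableEq Q]

/-- The operators that are products of operators supported on the sets of a list, in this order. -/
def words : List (Finset Q) → Set (Matrix (Q → Bool) (Q → Bool) ℂ)
  | [] => {1}
  | S :: w => Set.image2 (· * ·) {M | SupportedOn S M} (words w)

lemma mem_words_append {w w' : List (Finset Q)} {M M' : Matrix (Q → Bool) (Q → Bool) ℂ}
    (h : M ∈ words w) (h' : M' ∈ words w') : M * M' ∈ words (w ++ w') := by
  induction w generalizing M with
  | nil =>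
    rw [words, Set.mem_singleton_iff] at h
    simpa [h] using h'
  | cons S w ih =>
    obtain ⟨A, hA, B, hB, rfl⟩ := h
    refine ⟨A, hA, B * M', ih hB, ?_⟩
    simp only [mul_assoc]

lemma mem_words_singleton {S : Finset Q} {M : Matrix (Q → Bool) (Q → Bool) ℂ}
    (h : SupportedOn S M) : M ∈ words [S] :=
  ⟨M, h, 1, rfl, mul_one M⟩

lemma SupportedOn.mul {S : Finset Q} {M N : Matrix (Q → Bool) (Q → Bool) ℂ}
    (hM : SupportedOn S M) (hN : SupportedOn S N) : SupportedOn S (M * N) := by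
  obtain ⟨V, rfl⟩ := hM
  obtain ⟨W, rfl⟩ := hN
  exact ⟨V * W, onQubits_mul S V W⟩

lemma supportedOn_one (S : Finset Q) :
    SupportedOn S (1 : Matrix (Q → Bool) (Q → Bool) ℂ) := ⟨1, onQubits_one S⟩

lemma supportedOn_of_mem_words {R : Finset Q} {w : List (Finset Q)} (hw : ∀ S ∈ w, S ⊆ R)
    {M : Matrix (Q → Bool) (Q → Bool) ℂ} (h : M ∈ words w) : SupportedOn R M := by
  induction w generalizing M with
  | nil =>
    rw [words, Set.mem_singleton_iff] at h
    rw [h]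
    exact supportedOn_one R
  | cons S w ih =>
    obtain ⟨A, hA, B, hB, rfl⟩ := h
    exact (SupportedOn.mono (hw S (by simp)) hA).mul
      (ih (fun S hS => hw S (List.mem_cons_of_mem _ hS)) hB)

lemma coveredBy_words (w : List (Finset Q)) : CoveredBy (2 * weight w) (words w) := by
  induction w with
  | nil => exact coveredBy_singleton 1
  | cons S w ih =>
    refine ((coveredBy_supportedOn S).mul ih).mono subset_rfl ?_
    simp only [weight, List.map_cons, List.sum_cons]
    lia

end Words

/-! ### Normal form of circuits -/

section NormalForm

variable {n k m : ℕ} {π : Fin n → Fin k}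

lemma disjoint_qubitsOf {i j : Fin k} (hij : i ≠ j) :
    Disjoint (qubitsOf m π i) (qubitsOf m π j) := by
  rw [Finset.disjoint_left]
  intro q hi hj
  rw [mem_qubitsOf] at hi hj
  exact hij (hi.symm.trans hj)

/-- `V ↦ V ⊗ I` as a homomorphism. -/
def onQubitsHom {Q : Type} [Fintype Q] [DecidableEq Q] (S : Finset Q) :
    Matrix (S → Bool) (S → Bool) ℂ →* Matrix (Q → Bool) (Q → Bool) ℂ where
  toFun := onQubits S
  map_one' := onQubits_one S
  map_mul' := onQubits_mul S

lemma pairwise_commute_onQubitsHom (m : ℕ) (π : Fin n → Fin k) :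
    Pairwise fun i j => ∀ (V : Matrix (qubitsOf m π i → Bool) (qubitsOf m π i → Bool) ℂ)
      (W : Matrix (qubitsOf m π j → Bool) (qubitsOf m π j → Bool) ℂ),
      Commute (onQubitsHom (qubitsOf m π i) V) (onQubitsHom (qubitsOf m π j) W) :=
  fun _ _ hij _ _ =>
    SupportedOn.commute (disjoint_qubitsOf hij) (supportedOn_onQubits _ _)
      (supportedOn_onQubits _ _)

/-- The tensor product of one operator on each processor. -/
noncomputable def localHom (m : ℕ) (π : Fin n → Fin k) :
    (∀ i : Fin k, Matrix (qubitsOf m π i → Bool) (qubitsOf m π i → Bool) ℂ) →*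
      Matrix (Qubit n k m → Bool) (Qubit n k m → Bool) ℂ :=
  MonoidHom.noncommPiCoprod (fun i => onQubitsHom (qubitsOf m π i))
    (pairwise_commute_onQubitsHom m π)

lemma localHom_mulSingle (i : Fin k)
    (V : Matrix (qubitsOf m π i → Bool) (qubitsOf m π i → Bool) ℂ) :
    localHom m π (Pi.mulSingle i V) = onQubits (qubitsOf m π i) V := by
  rw [localHom, MonoidHom.noncommPiCoprod_mulSingle]
  rfl

/-- The qubits of the processors in `P`. -/
def qubitsIn (m : ℕ) (π : Fin n → Fin k) (P : Finset (Fin k)) : Finset (Qubit n k m) :=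
  Finset.univ.filter fun q => proc π q ∈ P

lemma mem_qubitsIn {P : Finset (Fin k)} {q : Qubit n k m} : q ∈ qubitsIn m π P ↔ proc π q ∈ P := by
  simp [qubitsIn]

lemma qubitsOf_subset_qubitsIn {P : Finset (Fin k)} {i : Fin k} (hi : i ∈ P) :
    qubitsOf m π i ⊆ qubitsIn m π P := by
  intro q hq
  rw [mem_qubitsOf] at hq
  rwa [mem_qubitsIn, hq]

lemma localHom_supportedOn {P : Finset (Fin k)}
    {V : ∀ i : Fin k, Matrix (qubitsOf m π i → Bool) (qubitsOf m π i → Bool) ℂ}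
    (hV : ∀ i, i ∉ P → V i = 1) : SupportedOn (qubitsIn m π P) (localHom m π V) := by
  rw [localHom, MonoidHom.noncommPiCoprod_apply]
  refine Finset.noncommProd_induction Finset.univ _ _ (SupportedOn (qubitsIn m π P))
    (fun _ _ => SupportedOn.mul) (supportedOn_one _) fun i _ => ?_
  change SupportedOn _ (onQubitsHom (qubitsOf m π i) (V i))
  by_cases hi : i ∈ P
  · exact (supportedOn_onQubits _ (V i)).mono (qubitsOf_subset_qubitsIn hi)
  · rw [hV i hi, map_one]
    exact supportedOn_one _

lemma eq_mulSingle_mul_update (i : Fin k)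
    (V : ∀ i : Fin k, Matrix (qubitsOf m π i → Bool) (qubitsOf m π i → Bool) ℂ) :
    V = Pi.mulSingle i (V i) * Function.update V i 1 := by
  funext j
  by_cases hj : j = i
  · subst hj; simp
  · simp [hj]

/-- Operators on the processors in `P` form a word with `|P|` letters. -/
lemma localHom_mem_words {c : ℕ} (hc : ∀ i, (qubitsOf m π i).card ≤ c) (P : Finset (Fin k)) :
    ∀ V : ∀ i : Fin k, Matrix (qubitsOf m π i → Bool) (qubitsOf m π i → Bool) ℂ,
      (∀ i, i ∉ P → V i = 1) →
      ∃ w, localHom m π V ∈ words w ∧ (∀ S ∈ w, S ⊆ qubitsIn m π P) ∧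
        weight w ≤ P.card * 4 ^ c := by
  induction P using Finset.induction_on with
  | empty =>
    intro V hV
    have : V = 1 := funext fun i => hV i (by simp)
    exact ⟨[], by rw [this, map_one]; rfl, by simp, by simp [weight]⟩
  | insert a P ha ih =>
    intro V hV
    obtain ⟨w, hw, hsub, hwt⟩ := ih (Function.update V a 1) (by
      intro i hi
      by_cases hia : i = a
      · subst hia; simp
      · rw [Function.update_of_ne hia]
        exact hV i (by simp [hia, hi]))
    refine ⟨qubitsOf m π a :: w, ?_, ?_, ?_⟩
    · rw [eq_mulSingle_mul_update a V, map_mul, localHom_mulSingle]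
      exact ⟨_, supportedOn_onQubits _ _, _, hw, rfl⟩
    · intro S hS
      rcases List.mem_cons.1 hS with rfl | hS
      · exact qubitsOf_subset_qubitsIn (by simp)
      · refine (hsub S hS).trans fun q hq => ?_
        rw [mem_qubitsIn] at hq ⊢
        exact Finset.mem_insert_of_mem hq
    · have h4 : 4 ^ (qubitsOf m π a).card ≤ 4 ^ c := Nat.pow_le_pow_right (by norm_num) (hc a)
      rw [Finset.card_insert_of_notMem ha, add_mul, one_mul]
      simp only [weight, List.map_cons, List.sum_cons] at hwt ⊢
      lia

/-- Normal form of a circuit: local gates are delayed until a nonlocal gate needs them, so each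
nonlocal gate comes with one local gate on either side, and one layer of local gates remains. -/
lemma exists_normalForm {G : SimpleGraph (Fin k)} {c : ℕ} (hc : ∀ i, (qubitsOf m π i).card ≤ c)
    (T : Circuit m G π) :
    ∃ w M V, ∃ P : Finset (Fin k), M ∈ words w ∧ Circuit.toMatrix T = M * localHom m π V ∧
      (∀ S ∈ w, S ⊆ qubitsIn m π P) ∧ P.card ≤ 2 * Circuit.numNonlocal T ∧
      weight w ≤ Circuit.numNonlocal T * (2 * 4 ^ c + 16) := by
  induction T with
  | nil => exact ⟨[], 1, 1, ∅, rfl, by simp [Circuit.toMatrix], by simp, by simp, by simp [weight]⟩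
  | cons g T ih =>
    obtain ⟨w, M, V, P, hM, hT, hsub, hP, hwt⟩ := ih
    cases g with
    | loc i W =>
      refine ⟨w, M, V * Pi.mulSingle i W.1, P, hM, ?_, hsub, ?_, ?_⟩
      · rw [Circuit.toMatrix, hT, map_mul, localHom_mulSingle, Gate.toMatrix, mul_assoc]
      · simpa [Circuit.numNonlocal, Gate.cost] using hP
      · simpa [Circuit.numNonlocal, Gate.cost] using hwt
    | nonloc p q h W =>
      have hne : proc π p ≠ proc π q := h.ne
      have hcost : Circuit.numNonlocal (Gate.nonloc p q h W :: T) = Circuit.numNonlocal T + 1 := by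
        simp [Circuit.numNonlocal, Gate.cost, add_comm]
      set i := proc π p with hi
      set j := proc π q with hj
      let V' := Function.update (Function.update V i 1) j 1
      have hV : localHom m π V = onQubits (qubitsOf m π i) (V i) *
          (onQubits (qubitsOf m π j) (V j) * localHom m π V') := by
        conv_lhs =>
          rw [eq_mulSingle_mul_update i V, eq_mulSingle_mul_update j (Function.update V i 1)]
        rw [map_mul, map_mul, localHom_mulSingle, localHom_mulSingle,
          Function.update_of_ne hne.symm]
      have hcomm : Commute (localHom m π V') (onQubits {p, q} W.1) := by
        refine SupportedOn.commute (S := qubitsIn m π {i, j}ᶜ) ?_ (localHom_supportedOn ?_)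
          (supportedOn_onQubits _ _)
        · rw [Finset.disjoint_left]
          intro r hr hr'
          rw [mem_qubitsIn] at hr
          simp only [Finset.mem_insert, Finset.mem_singleton] at hr'
          rcases hr' with rfl | rfl <;> simp [hi, hj] at hr
        · intro l hl
          simp only [Finset.mem_compl, not_not, Finset.mem_insert, Finset.mem_singleton] at hl
          rcases hl with rfl | rfl
          · simp [V', Function.update_of_ne hne]
          · simp [V']
      refine ⟨w ++ [qubitsOf m π i] ++ [qubitsOf m π j] ++ [{p, q}],
        M * onQubits (qubitsOf m π i) (V i) * onQubits (qubitsOf m π j) (V j) * onQubits {p, q} W.1,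
        V', P ∪ {i, j}, ?_, ?_, ?_, ?_, ?_⟩
      · refine mem_words_append (mem_words_append (mem_words_append hM ?_) ?_) ?_ <;>
          exact mem_words_singleton (supportedOn_onQubits _ _)
      · rw [Circuit.toMatrix, hT, hV, Gate.toMatrix]
        simp only [mul_assoc]
        rw [hcomm.eq]
      · intro S hS
        simp only [List.mem_append, List.mem_singleton] at hS
        rcases hS with ((hS | rfl) | rfl) | rfl
        · refine (hsub S hS).trans fun q hq => ?_
          rw [mem_qubitsIn] at hq ⊢
          exact Finset.mem_union_left _ hq
        · exact qubitsOf_subset_qubitsIn (by simp)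
        · exact qubitsOf_subset_qubitsIn (by simp)
        · intro r hr
          simp only [Finset.mem_insert, Finset.mem_singleton] at hr
          rcases hr with rfl | rfl <;> simp [mem_qubitsIn, hi, hj]
      · have := (Finset.card_union_le P {i, j}).trans (Nat.add_le_add_left Finset.card_le_two _)
        rw [hcost]
        lia
      · have h1 : 4 ^ (qubitsOf m π i).card ≤ 4 ^ c := Nat.pow_le_pow_right (by norm_num) (hc i)
        have h2 : 4 ^ (qubitsOf m π j).card ≤ 4 ^ c := Nat.pow_le_pow_right (by norm_num) (hc j)
        have h3 : 4 ^ ({p, q} : Finset (Qubit n k m)).card ≤ 4 ^ 2 :=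
          Nat.pow_le_pow_right (by norm_num) Finset.card_le_two
        rw [hcost, weight_append, weight_append, weight_append]
        simp only [weight, List.map_cons, List.sum_cons, List.map_nil, List.sum_nil] at hwt ⊢
        lia

end NormalForm

/-! ### Projection to the zero state of the ancillas -/

section Compression

variable {n k m : ℕ} {π : Fin n → Fin k}

/-- The basis state with data bits `x` and all ancillas `0`. -/
def withZeros (k m : ℕ) (x : Fin n → Bool) : Qubit n k m → Bool := Sum.elim x fun _ => false

/-- The block `⟨0…0| M |0…0⟩` of an operator at the zero state of the ancillas. -/
def compress (M : Matrix (Qubit n k m → Bool) (Qubit n k m → Bool) ℂ) :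
    Matrix (Fin n → Bool) (Fin n → Bool) ℂ :=
  M.submatrix (withZeros k m) (withZeros k m)

lemma compress_toMatrix {G : SimpleGraph (Fin k)} {T : Circuit m G π} {U : QubitUnitary (Fin n)}
    (h : T.Implements U) : compress (Circuit.toMatrix T) = U.1 := by
  ext x y
  have h1 := congrFun (h (Pi.single y 1)) (withZeros k m x)
  have h2 : withAncillas k m (Pi.single y (1 : ℂ)) = Pi.single (withZeros k m y) 1 := by
    funext z
    by_cases hz : z = withZeros k m y
    · subst hz
      rw [Pi.single_eq_same, withAncillas, if_pos fun a => by rfl]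
      exact Pi.single_eq_same y 1
    · rw [Pi.single_eq_of_ne hz, withAncillas]
      split_ifs with h0
      · rw [Pi.single_eq_of_ne]
        rintro rfl
        refine hz (funext fun q => ?_)
        rcases q with j | a
        · rfl
        · exact h0 a
      · rfl
  rw [h2, mulVec_single_one, mulVec_single_one, withAncillas, if_pos fun a => by rfl] at h1
  exact h1

/-- An implemented unitary is, up to a scalar, the compression of a word: processors that hold no
data and take part in no nonlocal gate contribute only the scalar. This is what makes the count of
parameters independent of `k`. -/
lemma exists_word {G : SimpleGraph (Fin k)} {c : ℕ} (hc : ∀ i, (qubitsOf m π i).card ≤ c)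
    {T : Circuit m G π} {U : QubitUnitary (Fin n)} (h : T.Implements U) :
    ∃ w : List (Finset (Qubit n k m)), ∃ M ∈ words w, ∃ s : ℂ, U.1 = s • compress M ∧
      weight w ≤ Circuit.numNonlocal T * (2 * 4 ^ c + 16) +
        (n + 2 * Circuit.numNonlocal T) * 4 ^ c := by
  obtain ⟨w, M, V, P, hM, hT, hsub, hP, hwt⟩ := exists_normalForm hc T
  let R := P ∪ Finset.univ.image π
  have hR : R.card ≤ n + 2 * Circuit.numNonlocal T := by
    have h1 := Finset.card_union_le P (Finset.univ.image π)
    have h2 : (Finset.univ.image π).card ≤ n := by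
      simpa using Finset.card_image_le (s := Finset.univ) (f := π)
    lia
  let V₁ : ∀ i : Fin k, Matrix (qubitsOf m π i → Bool) (qubitsOf m π i → Bool) ℂ :=
    fun i => if i ∈ R then V i else 1
  let V₂ : ∀ i : Fin k, Matrix (qubitsOf m π i → Bool) (qubitsOf m π i → Bool) ℂ :=
    fun i => if i ∈ R then 1 else V i
  have hV : V = V₁ * V₂ := by
    funext i
    by_cases hi : i ∈ R <;> simp [V₁, V₂, hi]
  obtain ⟨w', hw', hsub', hwt'⟩ := localHom_mem_words hc R V₁ fun i hi => by simp [V₁, hi]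
  have hmem := mem_words_append hM hw'
  have hsupp : SupportedOn (qubitsIn m π R) (M * localHom m π V₁) := by
    refine supportedOn_of_mem_words (w := w ++ w') ?_ hmem
    intro S hS
    rcases List.mem_append.1 hS with hS | hS
    · refine (hsub S hS).trans fun q hq => ?_
      rw [mem_qubitsIn] at hq ⊢
      exact Finset.mem_union_left _ hq
    · exact hsub' S hS
  have hsupp' : SupportedOn (qubitsIn m π R)ᶜ (localHom m π V₂) := by
    refine (localHom_supportedOn (P := Rᶜ) fun i hi => ?_).mono fun q hq => ?_
    · rw [Finset.mem_compl, not_not] at hi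
      simp [V₂, hi]
    · rw [mem_qubitsIn, Finset.mem_compl] at hq
      rwa [Finset.mem_compl, mem_qubitsIn]
  obtain ⟨X, hX⟩ := hsupp
  obtain ⟨Y, hY⟩ := hsupp'
  have hoff : ∀ q : Qubit n k m, q ∉ qubitsIn m π R →
      ∀ x : Fin n → Bool, withZeros k m x q = false := by
    intro q hq x
    rcases q with j | a
    · exact absurd (mem_qubitsIn.2 (Finset.mem_union_right _ (Finset.mem_image_of_mem π
        (Finset.mem_univ j)))) hq
    · rfl
  refine ⟨w ++ w', _, hmem, Y (fun _ => false) (fun _ => false), ?_, ?_⟩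
  · rw [← compress_toMatrix h, hT, hV, map_mul, ← mul_assoc, ← hX, ← hY]
    ext x y
    rw [compress, submatrix_apply, onQubits_mul_onQubits_compl, Matrix.smul_apply, compress,
      submatrix_apply, onQubits_apply, if_pos, smul_eq_mul, mul_comm]
    · congr 2
      · funext q; exact hoff q (Finset.mem_compl.1 q.2) x
      · funext q; exact hoff q (Finset.mem_compl.1 q.2) y
    · intro q hq
      rw [hoff q hq, hoff q hq]
  · rw [weight_append]
    have := Nat.mul_le_mul_right (4 ^ c) hR
    lia

/-- Some unitary needs words of large weight. -/
lemma exists_unitary_weight (n k m t : ℕ) (ht : 2 * t + 3 < 4 ^ n) :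
    ∃ U : QubitUnitary (Fin n), ∀ w : List (Finset (Qubit n k m)), ∀ M ∈ words w, ∀ s : ℂ,
      U.1 = s • compress M → t < weight w := by
  let A : {w : List (Finset (Qubit n k m)) // weight w ≤ t} →
      Set (Matrix (Fin n → Bool) (Fin n → Bool) ℂ) := fun w =>
    Set.image2 (fun (s : Matrix Unit Unit ℂ) M => s () () • compress M) Set.univ (words w.1)
  have hA : ∀ w, CoveredBy (2 + 2 * t) (A w) := by
    rintro ⟨w, hw⟩
    refine ((coveredBy_univ (ι := Unit) (κ := Unit)).image2 (coveredBy_words w) _ ?_).mono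
      subset_rfl (by simp; lia)
    intro f g hf hg i j
    exact (hf () ()).mul (hg _ _)
  have hd : 2 + 2 * t + 1 < Fintype.card (Fin n → Bool) * Fintype.card (Fin n → Bool) := by
    simp only [Fintype.card_fun, Fintype.card_bool, Fintype.card_fin, ← mul_pow]
    norm_num
    lia
  obtain ⟨U, hU⟩ := exists_unitary_notMem A hA hd
  refine ⟨U, fun w M hM s hs => ?_⟩
  by_contra! hw
  exact hU ⟨w, hw⟩ ⟨Matrix.of fun _ _ => s, trivial, M, hM, hs.symm⟩

end Compression

/-! ### Operator Schmidt rank -/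

section Schmidt

variable {Q : Type} [Fintype Q] [DecidableEq Q]

/-- The operator has Schmidt rank at most `D` across the cut `S | Sᶜ`: it is a sum of `D` products
of an operator on `S` and an operator on the complement. -/
def SchmidtRankLE (S : Finset Q) (D : ℕ) (M : Matrix (Q → Bool) (Q → Bool) ℂ) : Prop :=
  ∃ X Y : Fin D → Matrix (Q → Bool) (Q → Bool) ℂ, (∀ j, SupportedOn S (X j)) ∧
    (∀ j, SupportedOn Sᶜ (Y j)) ∧ M = ∑ j, X j * Y j

lemma schmidtRankLE_of_sum {S : Finset Q} {ι : Type} [Fintype ι]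
    (X Y : ι → Matrix (Q → Bool) (Q → Bool) ℂ) (hX : ∀ j, SupportedOn S (X j))
    (hY : ∀ j, SupportedOn Sᶜ (Y j)) {D : ℕ} (hD : Fintype.card ι = D) :
    SchmidtRankLE S D (∑ j, X j * Y j) := by
  let e := (Fintype.equivFinOfCardEq hD).symm
  exact ⟨X ∘ e, Y ∘ e, fun j => hX _, fun j => hY _,
    (Equiv.sum_comp e fun j => X j * Y j).symm⟩

lemma SchmidtRankLE.mul {S : Finset Q} {D D' : ℕ} {M M' : Matrix (Q → Bool) (Q → Bool) ℂ}
    (h : SchmidtRankLE S D M) (h' : SchmidtRankLE S D' M') : SchmidtRankLE S (D * D') (M * M') := by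
  obtain ⟨X, Y, hX, hY, rfl⟩ := h
  obtain ⟨X', Y', hX', hY', rfl⟩ := h'
  have : (∑ j, X j * Y j) * ∑ j, X' j * Y' j =
      ∑ l : Fin D × Fin D', (X l.1 * X' l.2) * (Y l.1 * Y' l.2) := by
    rw [Finset.sum_mul_sum, Fintype.sum_prod_type]
    refine Finset.sum_congr rfl fun i _ => Finset.sum_congr rfl fun j _ => ?_
    have hc : X' j * Y i = Y i * X' j :=
      (SupportedOn.commute (disjoint_compl_right) (hX' j) (hY i)).eq
    rw [mul_assoc, ← mul_assoc (Y i), ← hc]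
    simp only [mul_assoc]
  rw [this]
  exact schmidtRankLE_of_sum _ _ (fun l => (hX _).mul (hX' _)) (fun l => (hY _).mul (hY' _))
    (by simp)

lemma SupportedOn.schmidtRankLE {S : Finset Q} {M : Matrix (Q → Bool) (Q → Bool) ℂ}
    (h : SupportedOn S M) : SchmidtRankLE S 1 M :=
  ⟨fun _ => M, fun _ => 1, fun _ => h, fun _ => supportedOn_one _, by simp⟩

lemma SupportedOn.schmidtRankLE_compl {S : Finset Q} {M : Matrix (Q → Bool) (Q → Bool) ℂ}
    (h : SupportedOn Sᶜ M) : SchmidtRankLE S 1 M :=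
  ⟨fun _ => 1, fun _ => M, fun _ => supportedOn_one _, fun _ => h, by simp⟩

lemma SchmidtRankLE.mono {S : Finset Q} {D D' : ℕ} {M : Matrix (Q → Bool) (Q → Bool) ℂ}
    (h : SchmidtRankLE S D M) (hD : D ≤ D') : SchmidtRankLE S D' M := by
  obtain ⟨X, Y, hX, hY, rfl⟩ := h
  have hzero : ∀ T : Finset Q, SupportedOn T (0 : Matrix (Q → Bool) (Q → Bool) ℂ) := fun T =>
    ⟨0, by ext x y; rw [onQubits_apply]; simp⟩
  have : ∑ j, X j * Y j = ∑ l : Fin D ⊕ Fin (D' - D), Sum.elim X 0 l * Sum.elim Y 0 l := by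
    simp
  rw [this]
  refine schmidtRankLE_of_sum _ _ ?_ ?_ (by simp; lia)
  · rintro (j | j)
    · exact hX j
    · exact hzero _
  · rintro (j | j)
    · exact hY j
    · exact hzero _

/-- A two-qubit gate across the cut has Schmidt rank at most `4`: expand it in the matrix units
of the qubit in `S`. -/
lemma schmidtRankLE_two {S : Finset Q} {p q : Q} (hp : p ∈ S) (hq : q ∉ S)
    {M : Matrix (Q → Bool) (Q → Bool) ℂ} (h : SupportedOn {p, q} M) : SchmidtRankLE S 4 M := by
  have hpq : p ≠ q := by rintro rfl; exact hq hp
  let X : Bool × Bool → Matrix (Q → Bool) (Q → Bool) ℂ := fun l => Matrix.of fun x y =>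
    if (∀ r, r ≠ p → x r = y r) ∧ x p = l.1 ∧ y p = l.2 then 1 else 0
  let Y : Bool × Bool → Matrix (Q → Bool) (Q → Bool) ℂ := fun l => Matrix.of fun x y =>
    if ∀ r, r ≠ q → x r = y r then M (Function.update x p l.1) (Function.update y p l.2) else 0
  have hX : ∀ l, SupportedOn S (X l) := by
    intro l
    refine SupportedOn.mono (Finset.singleton_subset_iff.2 hp) (supportedOn_of_apply ?_ ?_)
    · rintro x y ⟨r, hr, hne⟩
      simp only [X, Matrix.of_apply]
      rw [if_neg]
      exact fun h => hne (h.1 r (by simpa using hr))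
    · intro x y x' y' hxy hxy' hx hy
      simp only [Finset.mem_singleton, forall_eq] at hx hy hxy hxy'
      have h1 : ∀ r, r ≠ p → x r = y r := hxy
      have h2 : ∀ r, r ≠ p → x' r = y' r := hxy'
      simp only [X, Matrix.of_apply, hx, hy]
      exact if_congr (and_congr_left' (iff_of_true h1 h2)) rfl rfl
  have hY : ∀ l, SupportedOn Sᶜ (Y l) := by
    intro l
    refine SupportedOn.mono (Finset.singleton_subset_iff.2 (Finset.mem_compl.2 hq))
      (supportedOn_of_apply ?_ ?_)
    · rintro x y ⟨r, hr, hne⟩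
      simp only [Y, Matrix.of_apply]
      rw [if_neg]
      exact fun h => hne (h r (by simpa using hr))
    · intro x y x' y' hxy hxy' hx hy
      simp only [Finset.mem_singleton, forall_eq] at hx hy hxy hxy'
      have h1 : ∀ r, r ≠ q → x r = y r := hxy
      have h2 : ∀ r, r ≠ q → x' r = y' r := hxy'
      simp only [Y, Matrix.of_apply]
      rw [if_pos h1, if_pos h2]
      refine h.apply_congr ?_ ?_ ?_ ?_
      · intro r hr
        simp only [Finset.mem_insert, Finset.mem_singleton, not_or] at hr
        rw [Function.update_of_ne hr.1, Function.update_of_ne hr.1, h1 r hr.2]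
      · intro r hr
        simp only [Finset.mem_insert, Finset.mem_singleton, not_or] at hr
        rw [Function.update_of_ne hr.1, Function.update_of_ne hr.1, h2 r hr.2]
      · intro r hr
        simp only [Finset.mem_insert, Finset.mem_singleton] at hr
        rcases hr with rfl | rfl
        · simp
        · rw [Function.update_of_ne hpq.symm, Function.update_of_ne hpq.symm, hx]
      · intro r hr
        simp only [Finset.mem_insert, Finset.mem_singleton] at hr
        rcases hr with rfl | rfl
        · simp
        · rw [Function.update_of_ne hpq.symm, Function.update_of_ne hpq.symm, hy]
  have hXY : ∀ l x y, (X l * Y l) x y =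
      if x p = l.1 ∧ y p = l.2 then M x y else 0 := by
    intro l x y
    rw [Matrix.mul_apply, Finset.sum_eq_single (Function.update x p (y p))]
    · simp only [X, Y, Matrix.of_apply, Function.update_self, Function.update_idem]
      by_cases hl : x p = l.1 ∧ y p = l.2
      · rw [if_pos hl, if_pos, one_mul, ← hl.1, ← hl.2, Function.update_eq_self,
          Function.update_eq_self]
        · split_ifs with hc
          · rfl
          · push Not at hc
            obtain ⟨r, hr, hne⟩ := hc
            have hrp : r ≠ p := by rintro rfl; simp at hne
            rw [Function.update_of_ne hrp] at hne
            exact (h.apply_eq_zero (q := r) (by simp [hr, hrp]) hne).symm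
        · exact ⟨fun r hr => by rw [Function.update_of_ne hr], hl⟩
      · rw [if_neg hl, if_neg, zero_mul]
        exact fun h => hl h.2
    · intro z _ hz
      simp only [X, Y, Matrix.of_apply]
      split_ifs with h1 h2
      · refine absurd (funext fun r => ?_) hz
        by_cases hr : r = p
        · subst hr
          rw [Function.update_self, h2 r hpq]
        · rw [Function.update_of_ne hr, h1.1 r hr]
      all_goals simp
    · simp
  have hsum : M = ∑ l, X l * Y l := by
    ext x y
    rw [Matrix.sum_apply, Finset.sum_eq_single (x p, y p)]
    · rw [hXY, if_pos ⟨rfl, rfl⟩]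
    · intro l _ hl
      rw [hXY, if_neg]
      rintro ⟨h1, h2⟩
      exact hl (Prod.ext h1.symm h2.symm)
    · simp
  rw [hsum]
  exact schmidtRankLE_of_sum X Y hX hY (by simp)

/-- The operators of Schmidt rank at most `D` across `S | Sᶜ` have few parameters. -/
lemma coveredBy_schmidtRankLE (S : Finset Q) (D : ℕ) :
    CoveredBy (D * (2 * 4 ^ S.card + 2 * 4 ^ (Sᶜ).card)) {M | SchmidtRankLE S D M} := by
  induction D with
  | zero =>
    refine (coveredBy_singleton 0).mono ?_ (Nat.zero_le _)
    rintro M ⟨X, Y, -, -, rfl⟩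
    simp
  | succ D ih =>
    refine (ih.add ((coveredBy_supportedOn S).mul (coveredBy_supportedOn Sᶜ))).mono ?_ ?_
    · rintro M ⟨X, Y, hX, hY, rfl⟩
      refine ⟨∑ j : Fin D, X j.castSucc * Y j.castSucc, ⟨fun j => X j.castSucc,
        fun j => Y j.castSucc, fun j => hX _, fun j => hY _, rfl⟩, X (Fin.last D) * Y (Fin.last D),
        ⟨_, hX _, _, hY _, rfl⟩, ?_⟩
      exact (Fin.sum_univ_castSucc fun j => X j * Y j).symm
    · rw [add_mul, one_mul]

end Schmidt

/-! ### Cuts of the processors -/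

section Cut

variable {n k m : ℕ} {π : Fin n → Fin k}

/-- Each nonlocal gate multiplies the Schmidt rank across a cut of the processors by at most `4`. -/
lemma schmidtRankLE_toMatrix {G : SimpleGraph (Fin k)} (P : Finset (Fin k)) (T : Circuit m G π) :
    SchmidtRankLE (qubitsIn m π P) (4 ^ Circuit.numNonlocal T) (Circuit.toMatrix T) := by
  have hcompl : ∀ q : Qubit n k m, q ∈ (qubitsIn m π P)ᶜ ↔ proc π q ∉ P := fun q => by
    rw [Finset.mem_compl, mem_qubitsIn]
  induction T with
  | nil => simpa [Circuit.toMatrix, Circuit.numNonlocal] using (supportedOn_one _).schmidtRankLE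
  | cons g T ih =>
    have hcost : Circuit.numNonlocal (g :: T) = Circuit.numNonlocal T + g.cost := by
      simp [Circuit.numNonlocal, add_comm]
    rw [hcost, pow_add, Circuit.toMatrix]
    refine ih.mul ?_
    cases g with
    | loc i V =>
      by_cases hi : i ∈ P
      · exact ((supportedOn_onQubits _ V.1).mono (qubitsOf_subset_qubitsIn hi)).schmidtRankLE
      · refine ((supportedOn_onQubits _ V.1).mono fun q hq => ?_).schmidtRankLE_compl
        rw [mem_qubitsOf] at hq
        rwa [hcompl, hq]
    | nonloc p q h V =>
      have hs := supportedOn_onQubits {p, q} V.1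
      change SchmidtRankLE _ (4 ^ 1) (onQubits {p, q} V.1)
      rw [pow_one]
      by_cases hp : proc π p ∈ P <;> by_cases hq : proc π q ∈ P
      · refine SchmidtRankLE.mono (SupportedOn.schmidtRankLE (hs.mono ?_)) (by norm_num)
        simp [Finset.insert_subset_iff, mem_qubitsIn, hp, hq]
      · exact schmidtRankLE_two (mem_qubitsIn.2 hp) (by rwa [mem_qubitsIn]) hs
      · refine schmidtRankLE_two (p := q) (q := p) (mem_qubitsIn.2 hq) (by rwa [mem_qubitsIn]) ?_
        rwa [Finset.pair_comm]
      · refine SchmidtRankLE.mono (SupportedOn.schmidtRankLE_compl (hs.mono ?_)) (by norm_num)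
        simp [Finset.insert_subset_iff, mem_qubitsIn, hp, hq]

lemma SupportedOn.compress {S : Finset (Qubit n k m)} {A : Finset (Fin n)}
    {M : Matrix (Qubit n k m → Bool) (Qubit n k m → Bool) ℂ} (h : SupportedOn S M)
    (hA : ∀ j, j ∈ A ↔ Sum.inl j ∈ S) : SupportedOn A (compress M) := by
  refine supportedOn_of_apply ?_ ?_
  · rintro x y ⟨j, hj, hne⟩
    exact h.apply_eq_zero (q := Sum.inl j) (by rwa [← hA]) hne
  · intro x y x' y' hxy hxy' hx hy
    refine h.apply_congr ?_ ?_ ?_ ?_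
    all_goals
      rintro (j | a) hj
      · first
          | exact hxy j (by rwa [hA])
          | exact hxy' j (by rwa [hA])
          | exact hx j (by rwa [hA])
          | exact hy j (by rwa [hA])
      · rfl

/-- Compression is multiplicative on operators with complementary supports. -/
lemma compress_mul {S : Finset (Qubit n k m)}
    {M N : Matrix (Qubit n k m → Bool) (Qubit n k m → Bool) ℂ} (hM : SupportedOn S M)
    (hN : SupportedOn Sᶜ N) : compress (M * N) = compress M * compress N := by
  ext x y
  rw [compress, submatrix_apply, Matrix.mul_apply, Matrix.mul_apply]
  symm
  refine Finset.sum_of_injOn (fun x : Fin n → Bool => withZeros k m x) ?_ (by simp) ?_ ?_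
  · intro x _ y _ hxy
    funext j
    exact congrFun hxy (Sum.inl j)
  · intro z _ hz
    obtain ⟨a, ha⟩ : ∃ a, z (Sum.inr a) ≠ false := by
      by_contra! hcon
      refine hz ⟨fun j => z (Sum.inl j), by simp, ?_⟩
      funext q
      rcases q with j | a
      · rfl
      · exact (hcon a).symm
    by_cases haS : Sum.inr a ∈ S
    · rw [hN.apply_eq_zero (q := Sum.inr a) (by simpa using haS) ha, mul_zero]
    · rw [hM.apply_eq_zero haS fun h => ha h.symm, zero_mul]
  · intro z _
    rfl

lemma SchmidtRankLE.compress {S : Finset (Qubit n k m)} {A : Finset (Fin n)} {D : ℕ}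
    {M : Matrix (Qubit n k m → Bool) (Qubit n k m → Bool) ℂ} (h : SchmidtRankLE S D M)
    (hA : ∀ j, j ∈ A ↔ Sum.inl j ∈ S) : SchmidtRankLE A D (compress M) := by
  obtain ⟨X, Y, hX, hY, rfl⟩ := h
  refine ⟨fun j => DistQC.compress (X j), fun j => DistQC.compress (Y j),
    fun j => (hX j).compress hA,
    fun j => (hY j).compress fun l => by rw [Finset.mem_compl, Finset.mem_compl, hA], ?_⟩
  simp only [← compress_mul (hX _) (hY _)]
  ext x y
  simp [DistQC.compress, Matrix.sum_apply]

/-- Some unitary has large Schmidt rank across all cuts without a large side. -/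
lemma exists_unitary_schmidtRank (n s D : ℕ) (hD : 4 * D * 4 ^ s + 1 < 4 ^ n) :
    ∃ U : QubitUnitary (Fin n), ∀ A : Finset (Fin n), A.card ≤ s → (Aᶜ).card ≤ s →
      ¬ SchmidtRankLE A D U.1 := by
  let B : {A : Finset (Fin n) // A.card ≤ s ∧ (Aᶜ).card ≤ s} →
      Set (Matrix (Fin n → Bool) (Fin n → Bool) ℂ) := fun A => {M | SchmidtRankLE A.1 D M}
  have hB : ∀ A, CoveredBy (4 * D * 4 ^ s) (B A) := by
    rintro ⟨A, h1, h2⟩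
    refine (coveredBy_schmidtRankLE A D).mono subset_rfl ?_
    have h1 : 4 ^ A.card ≤ 4 ^ s := Nat.pow_le_pow_right (by norm_num) h1
    have h2 : 4 ^ (Aᶜ).card ≤ 4 ^ s := Nat.pow_le_pow_right (by norm_num) h2
    calc D * (2 * 4 ^ A.card + 2 * 4 ^ (Aᶜ).card) ≤ D * (4 * 4 ^ s) :=
          Nat.mul_le_mul_left D (by lia)
      _ = 4 * D * 4 ^ s := by ring
  have hd : 4 * D * 4 ^ s + 1 < Fintype.card (Fin n → Bool) * Fintype.card (Fin n → Bool) := by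
    simp only [Fintype.card_fun, Fintype.card_bool, Fintype.card_fin, ← mul_pow]
    norm_num
    lia
  obtain ⟨U, hU⟩ := exists_unitary_notMem B hB hd
  exact ⟨U, fun A h1 h2 h => hU ⟨A, h1, h2⟩ h⟩

/-- If no processor holds much more than half of the data, the processors can be cut into two groups
neither of which holds much more than three quarters of it. -/
lemma exists_cut (π : Fin n → Fin k) {s t : ℕ} (hn : 0 < n)
    (hπ : ∀ i, (Finset.univ.filter fun j => π j = i).card ≤ t) (hts : n + 4 * t ≤ 4 * s)
    (h3 : 3 * n ≤ 4 * s) :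
    ∃ P : Finset (Fin k), (Finset.univ.filter fun j => π j ∈ P).card ≤ s ∧
      (Finset.univ.filter fun j => π j ∈ P)ᶜ.card ≤ s := by
  -- The group is the shortest initial segment of processors that holds a quarter of the data.
  let a : ℕ → ℕ := fun l => (Finset.univ.filter fun j => (π j : ℕ) < l).card
  have hex : ∃ l, n ≤ 4 * a l := by
    refine ⟨k, ?_⟩
    have : a k = n := by simp [a]
    lia
  classical
  set l := Nat.find hex with hl
  have hl1 : n ≤ 4 * a l := Nat.find_spec hex
  obtain ⟨l', hl'⟩ : ∃ l', l = l' + 1 := by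
    refine Nat.exists_eq_succ_of_ne_zero fun h0 => ?_
    rw [h0] at hl1
    simp [a] at hl1
    lia
  have hl2 : 4 * a l' < n := by
    have := Nat.find_min hex (m := l') (by lia)
    lia
  have hstep : a (l' + 1) ≤ a l' + t := by
    have hsub : (Finset.univ.filter fun j => (π j : ℕ) < l' + 1) ⊆
        (Finset.univ.filter fun j => (π j : ℕ) < l') ∪
          Finset.univ.filter fun j => (π j : ℕ) = l' := by
      intro j hj
      simp only [Finset.mem_union, Finset.mem_filter, Finset.mem_univ, true_and] at hj ⊢
      lia
    have h1 : (Finset.univ.filter fun j => (π j : ℕ) = l').card ≤ t := by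
      by_cases hk : l' < k
      · refine le_trans (le_of_eq ?_) (hπ ⟨l', hk⟩)
        congr 1
        ext j
        simp [Fin.ext_iff]
      · rw [Finset.card_eq_zero.2]
        · exact Nat.zero_le _
        · refine Finset.filter_eq_empty_iff.2 fun j _ => ?_
          have := (π j).2
          lia
    exact (Finset.card_le_card hsub).trans ((Finset.card_union_le _ _).trans
      (Nat.add_le_add_left h1 _))
  refine ⟨Finset.univ.filter fun i => (i : ℕ) < l, ?_, ?_⟩
  · simp only [Finset.mem_filter, Finset.mem_univ, true_and]
    change a l ≤ s
    rw [hl']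
    lia
  · simp only [Finset.mem_filter, Finset.mem_univ, true_and]
    rw [Finset.card_compl, Fintype.card_fin]
    change n - a l ≤ s
    lia

end Cut

/-! ### The lower bound -/

section LowerBound

variable {n k m : ℕ}

lemma card_qubitsOf (π : Fin n → Fin k) (i : Fin k) :
    (qubitsOf m π i).card = (Finset.univ.filter fun j => π j = i).card + m := by
  have : qubitsOf m π i = (Finset.univ.filter fun j => π j = i).disjSum
      ((Finset.univ : Finset (Fin m)).map
        ⟨fun l => (i, l), fun a b h => (Prod.ext_iff.1 h).2⟩) := by
    ext q
    rcases q with j | ⟨i', l⟩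
    · simp [mem_qubitsOf, proc]
    · simp only [mem_qubitsOf, proc, Sum.elim_inr, Finset.inr_mem_disjSum, Finset.mem_map,
        Finset.mem_univ, true_and]
      exact ⟨fun h => ⟨l, by rw [← h]; rfl⟩, fun ⟨_, h⟩ => (congrArg Prod.fst h).symm⟩
  rw [this, Finset.card_disjSum, Finset.card_map, Finset.card_univ, Fintype.card_fin]

lemma Balanced.card_lt {b : ℝ} {π : Fin n → Fin k} (hπ : Balanced b π) (i : Fin k) :
    ((Finset.univ.filter fun j => π j = i).card : ℝ) < n / k + b := by
  have := (abs_lt.1 (hπ i)).2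
  linarith

/-- Some unitary is hard by the count of parameters. -/
lemma exists_unitary_pow_le {b : ℝ} (hb : 0 ≤ b) (n k m : ℕ) (hn : 2 ≤ n) :
    ∃ U : QubitUnitary (Fin n), ∀ (π : Fin n → Fin k), Balanced b π →
      ∀ T : Circuit m (⊤ : SimpleGraph (Fin k)) π, T.Implements U →
        (4 : ℝ) ^ ((1 - 1 / (k : ℝ)) * (n : ℝ) - (m : ℝ)) ≤
          80 * 4 ^ b * ((Circuit.numNonlocal T : ℝ) + n) := by
  have h4n : 4 ^ n = 4 * 4 ^ (n - 1) := by
    rw [← pow_succ']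
    congr 1
    lia
  have h41 : 4 ^ 1 ≤ 4 ^ (n - 1) := Nat.pow_le_pow_right (by norm_num) (by lia)
  obtain ⟨U, hU⟩ := exists_unitary_weight n k m (4 ^ (n - 1)) (by lia)
  refine ⟨U, fun π hπ T hT => ?_⟩
  set r := Circuit.numNonlocal T
  let c := ⌊(n : ℝ) / k + b⌋₊ + m
  have hc : ∀ i, (qubitsOf m π i).card ≤ c := fun i => by
    rw [card_qubitsOf]
    exact Nat.add_le_add_right (Nat.le_floor (hπ.card_lt i).le) m
  obtain ⟨w, M, hM, s, hs, hw⟩ := exists_word hc hT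
  have h1 : 4 ^ (n - 1) ≤ 20 * (r + n) * 4 ^ c := by
    have hlt := (hU w M hM s hs).trans_le hw
    have hpos : 1 ≤ 4 ^ c := Nat.one_le_pow _ _ (by norm_num)
    nlinarith
  have h2 : (4 : ℝ) ^ n ≤ 80 * (r + n) * 4 ^ c := by
    have : 4 ^ n ≤ 80 * (r + n) * 4 ^ c := by rw [h4n]; lia
    exact_mod_cast this
  have h3 : (4 : ℝ) ^ c ≤ 4 ^ ((n : ℝ) / k + b + m) := by
    rw [← Real.rpow_natCast]
    refine Real.rpow_le_rpow_of_exponent_le (by norm_num) ?_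
    have : (⌊(n : ℝ) / k + b⌋₊ : ℝ) ≤ n / k + b := Nat.floor_le (by positivity)
    simp only [c]
    push_cast
    linarith
  have h4 : (4 : ℝ) ^ ((1 - 1 / (k : ℝ)) * (n : ℝ) - (m : ℝ)) =
      4 ^ n * 4 ^ b / 4 ^ ((n : ℝ) / k + b + m) := by
    rw [← Real.rpow_natCast, ← Real.rpow_add (by norm_num), ← Real.rpow_sub (by norm_num)]
    congr 1
    ring
  rw [h4, div_le_iff₀ (by positivity)]
  calc (4 : ℝ) ^ n * 4 ^ b ≤ 80 * (r + n) * 4 ^ c * 4 ^ b := by gcongr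
    _ ≤ 80 * (r + n) * 4 ^ ((n : ℝ) / k + b + m) * 4 ^ b := by gcongr
    _ = _ := by ring

/-- Some unitary is hard by its Schmidt rank. -/
lemma exists_unitary_le {b : ℝ} (n k m : ℕ) (hn : 16 * (⌈b⌉₊ + 3) ≤ n) (hk : 2 ≤ k) :
    ∃ U : QubitUnitary (Fin n), ∀ (π : Fin n → Fin k), Balanced b π →
      ∀ T : Circuit m (⊤ : SimpleGraph (Fin k)) π, T.Implements U →
        n ≤ 16 * Circuit.numNonlocal T := by
  set B := ⌈b⌉₊
  let s := 3 * n / 4 + 1 + B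
  have hpow : 4 * 4 ^ (n / 16) * 4 ^ s + 1 < 4 ^ n := by
    have h1 : 4 * 4 ^ (n / 16) * 4 ^ s = 4 ^ (n / 16 + 1 + s) := by ring
    have h2 : 4 ^ (n / 16 + 1 + s + 1) ≤ 4 ^ n :=
      Nat.pow_le_pow_right (by norm_num) (by simp only [s]; lia)
    have h3 : 1 ≤ 4 ^ (n / 16 + 1 + s) := Nat.one_le_pow _ _ (by norm_num)
    rw [h1]
    rw [pow_succ] at h2
    lia
  obtain ⟨U, hU⟩ := exists_unitary_schmidtRank n s (4 ^ (n / 16)) hpow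
  refine ⟨U, fun π hπ T hT => ?_⟩
  have hcard : ∀ i, (Finset.univ.filter fun j => π j = i).card ≤ n / 2 + B := by
    intro i
    have h1 := hπ.card_lt i
    have h2 : (n : ℝ) / k ≤ n / 2 := by
      have : (2 : ℝ) ≤ k := by exact_mod_cast hk
      gcongr
    have h3 : b ≤ B := Nat.le_ceil b
    have h4 : (2 : ℝ) * (Finset.univ.filter fun j => π j = i).card < n + 2 * B := by linarith
    have h5 : 2 * (Finset.univ.filter fun j => π j = i).card < n + 2 * B := by exact_mod_cast h4
    lia
  obtain ⟨P, hP, hP'⟩ := exists_cut (s := s) π (by lia) hcard (by simp only [s]; lia)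
    (by simp only [s]; lia)
  by_contra! hcon
  refine hU _ hP hP' ?_
  rw [← compress_toMatrix hT]
  refine ((schmidtRankLE_toMatrix P T).compress fun j => ?_).mono
    (Nat.pow_le_pow_right (by norm_num) (by lia))
  simp [mem_qubitsIn, proc]

lemma le_commComplexity {b x : ℝ} {U : QubitUnitary (Fin n)}
    (h : ∀ (π : Fin n → Fin k), Balanced b π →
      ∀ T : Circuit m (⊤ : SimpleGraph (Fin k)) π, T.Implements U → x ≤ Circuit.numNonlocal T) :
    ENNReal.ofReal x ≤ ((commComplexity b k m U : ℕ∞) : ENNReal) := by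
  have h1 : ((⌈x⌉₊ : ℕ) : ℕ∞) ≤ commComplexity b k m U := by
    refine le_iInf₂ fun π hπ => le_iInf₂ fun T hT => ?_
    exact_mod_cast Nat.ceil_le.2 (h π hπ T hT)
  calc ENNReal.ofReal x ≤ ENNReal.ofReal (⌈x⌉₊ : ℕ) := ENNReal.ofReal_le_ofReal (Nat.le_ceil x)
    _ = (((⌈x⌉₊ : ℕ) : ℕ∞) : ENNReal) := by rw [ENNReal.ofReal_natCast, ENat.toENNReal_coe]
    _ ≤ _ := by exact_mod_cast h1

theorem lowerBound {b : ℝ} (hb : 1 ≤ b) (n k m : ℕ) (hn : 16 * (⌈b⌉₊ + 3) ≤ n) (hk : 2 ≤ k) :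
    ∃ U : QubitUnitary (Fin n), ENNReal.ofReal (1 / (2560 * 4 ^ b) * commBound n k m) ≤
      ((commComplexity b k m U : ℕ∞) : ENNReal) := by
  have h4b : (1 : ℝ) ≤ 4 ^ b := Real.one_le_rpow (by norm_num) (by linarith)
  have hn0 : (0 : ℝ) ≤ n := by positivity
  set X : ℝ := (4 : ℝ) ^ ((1 - 1 / (k : ℝ)) * (n : ℝ) - (m : ℝ)) with hX
  have hX0 : 0 < X := by positivity
  rcases le_or_gt (160 * 4 ^ b * (n : ℝ)) X with hcase | hcase
  · -- The count of parameters loses an additive `n`, which is absorbed here.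
    obtain ⟨U, hU⟩ := exists_unitary_pow_le (b := b) (by linarith) n k m (by lia)
    refine ⟨U, le_commComplexity fun π hπ T hT => ?_⟩
    have h1 := hU π hπ T hT
    have hmax : commBound n k m = X := max_eq_left (by nlinarith)
    have hr : (0 : ℝ) ≤ Circuit.numNonlocal T := by positivity
    rw [hmax, one_div_mul_eq_div, div_le_iff₀ (by positivity)]
    rw [← hX] at h1
    nlinarith
  · obtain ⟨U, hU⟩ := exists_unitary_le (b := b) n k m hn hk
    refine ⟨U, le_commComplexity fun π hπ T hT => ?_⟩
    have h1 : (n : ℝ) ≤ 16 * Circuit.numNonlocal T := by exact_mod_cast hU π hπ T hT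
    have hmax : commBound n k m ≤ 160 * 4 ^ b * n := max_le hcase.le (by nlinarith)
    rw [one_div_mul_eq_div, div_le_iff₀ (by positivity)]
    nlinarith

end LowerBound

end DistQC

theorem theorem1 (b : ℝ) (hb : 1 ≤ b) :
    (∃ C : ℝ, 0 < C ∧ ∀ n k m : ℕ, 2 ≤ k → ∀ U : DistQC.QubitUnitary (Fin n),
      ((DistQC.commComplexity b k m U : ℕ∞) : ENNReal) ≤
        ENNReal.ofReal (C * DistQC.commBound n k m)) ∧
    (∃ c : ℝ, 0 < c ∧ ∃ n₀ : ℕ, ∀ n k m : ℕ, n₀ ≤ n → 2 ≤ k →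
      ∃ U : DistQC.QubitUnitary (Fin n),
        ENNReal.ofReal (c * DistQC.commBound n k m) ≤
          ((DistQC.commComplexity b k m U : ℕ∞) : ENNReal)) :=
  ⟨⟨20, by norm_num, fun n k m hk U => DistQC.upperBound hb n k m hk U⟩,
    ⟨1 / (2560 * 4 ^ b), by positivity, 16 * (⌈b⌉₊ + 3), fun n k m hn hk =>
      DistQC.lowerBound hb n k m hn hk⟩⟩
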